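/- **Setting.** Let $(\Omega,\mu)$ be a finite set with counting measure or a bounded rectangle in $\mathbb R^p$ with Lebesgue measure (more generally, any finite measure space). Fix a countable system of elementary regions: $\Omega$ is one of them; every region $A$ is measurable with $\mu(A)>0$, and can be partitioned in $M(A)\ge 0$ ways, the $j$-th being $A=\bigcup_{i=1}^{K^j}A_i^j$ into $K^j=K^j(A)\ge 2$ disjoint elementary regions. Parameters: a number $\rho(A)\in[0,1]$ with $\rho(A)=1$ if $M(A)=0$; if $M(A)>0$, a probability vector $\lambda(A)=(\lambda_1,\dots,\lambda_{M(A)})$; and vectors $\alpha^j=\alpha^j(A)$ with positive entries $\alpha_1^j,\dots,\alpha_{K^j}^j$, all nonrandom. Start from $Q^{(0)}$ uniform on $\Omega$. At each step, independently for every region $A$ of the current partition that is not yet stopped: with probability $\rho(A)$ stop partitioning $A$; otherwise choose $J=j$ with probability $\lambda_j$, draw $\theta^j\sim\mathrm{Dirichlet}(\alpha^j)$, split $A$ into $A_1^j,\dots,A_{K^j}^j$, and give $A_i^j$ the mass $Q^{(k)}(A)\theta_i^j$. $Q^{(k)}$ is uniform within each region of the partition after $k$ steps. If $Q^{(k)}$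 converges almost surely in variational distance to a random probability measure $Q$, then the law of $Q$ is called the *optional Pólya tree* with parameters $\rho,\lambda,\alpha$ (independent stopping rule). Starting the construction at $A$ instead of $\Omega$ gives the optional Pólya tree induced within $A$, whose random density with respect to $\mu$ is denoted $q(\cdot\mid A)$ (taken as the pointwise increasing limit of the densities on the stopped parts). For $\mathbf x=(x_1,\dots,x_n)\in\Omega^n$ let $n(A)=\#\{l: x_l\in A\}$, $\mathbf n^j=(n(A_1^j),\dots,n(A_{K^j}^j))$, $D(t)=\prod_i\Gamma(t_i)/\Gamma(\sum_i t_i)$, $$\Phi_0(A)=\mu(A)^{-n(A)},\qquad \Phi(A)=E\Big[\prod_{l:\,x_l\in A}q(x_l\mid A)\Big].$$ **Theorem.** Let $\pi$ be an optional Pólya tree with parameters $\rho,\lambda,\alpha$, and suppose that for some $\delta>0$, $\delta<\rho(A)<1-\delta$ for all $A$ with $M(A)>0$. Let $Q\sim\pi$ and, given $Q$, let $\mathbf X=(X_1,\dots,X_n)$ be independent observations from $Q$. Then: (a) For every $A$, $q(\cdot\mid A)$ is almost surely the density with respect to $\mu$ of the variational limit of the construction started at $A$. The marginal law of $\mathbf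 X$ has density $\mathbf x\mapsto\Phi(\Omega)$ with respect to $\mu^{n}$. For every $\mathbf x$ and $A$, $\Phi(A)=1$ if $n(A)=0$, and in $[0,\infty]$ $$\Phi(A)=\rho(A)\Phi_0(A)+(1-\rho(A))\sum_{j=1}^{M(A)}\lambda_j\frac{D(\mathbf n^j+\alpha^j)}{D(\alpha^j)}\prod_{i=1}^{K^j}\Phi(A_i^j).$$ (b) There is a regular conditional distribution of $Q$ given $\mathbf X$ such that, for almost every $\mathbf x$ with respect to the law of $\mathbf X$, one has $0<\Phi(A)<\infty$ for all $A$, and the conditional distribution given $\mathbf X=\mathbf x$ is the optional Pólya tree whose parameters at each region $A$ are: stopping probability $\rho(A\mid\mathbf x)=\rho(A)\Phi_0(A)/\Phi(A)$; selection probabilities $$\lambda_j(A\mid\mathbf x)=\frac{w_j}{\sum_{l=1}^{M(A)}w_l},\qquad w_j=\lambda_j\frac{D(\mathbf n^j+\alpha^j)}{D(\alpha^j)}\prod_{i=1}^{K^j}\Phi(A_i^j);$$ and assignment weights $\alpha^j(A\mid\mathbf x)=\mathbf n^j+\alpha^j$, that is, the probabilities $\theta^j$ of the subregions are drawn from $\mathrm{Dirichlet}(\mathbf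 n^j+\alpha^j)$. -/

import Mathlib

open MeasureTheory ProbabilityTheory
open scoped ENNReal

noncomputable section

namespace OptionalPolya

/-- A system for generating recursive partitions of a measure space `(Ω, μ)`.  The elements of `R`
label the elementary regions, including the whole space.  A region `A` can be partitioned in
`ways A` different ways (possibly none), and the `j`-th way splits it into `parts A j` regions,
at least two, which are disjoint, measurable and of positive measure. -/
structure PartitionScheme {Ω : Type*} [MeasurableSpace Ω] (R : Type*) (μ : Measure Ω) where
  /-- the subset of `Ω` described by a label -/
  toSet : R → Set Ω
  /-- the label of the whole space -/
  root : R
  /-- the number `M(A)` of ways to partition `A` -/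
  ways : R → ℕ
  /-- the number `K^j(A)` of parts of the `j`-th partition of `A` -/
  parts : ∀ A, Fin (ways A) → ℕ
  /-- the `i`-th part `A_i^j` of the `j`-th partition of `A` -/
  part : ∀ A j, Fin (parts A j) → R
  toSet_root : toSet root = Set.univ
  measurableSet_toSet : ∀ A, MeasurableSet (toSet A)
  measure_toSet_pos : ∀ A, 0 < μ (toSet A)
  two_le_parts : ∀ A j, 2 ≤ parts A j
  iUnion_part : ∀ A j, ⋃ i, toSet (part A j i) = toSet A
  disjoint_part : ∀ A j i i', i ≠ i' → Disjoint (toSet (part A j i)) (toSet (part A j i'))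

/-- What is decided at a region: to stop (`halt`), or to partition it in the `j`-th way. -/
inductive Decision (m : ℕ) : Type where
  | halt : Decision m
  | split (j : Fin m) : Decision m

instance (m : ℕ) : MeasurableSpace (Decision m) := ⊤

/-- The Dirichlet distribution with parameter `a`: the law of a vector of independent
`Gamma (a i, 1)` variables divided by its sum. -/
def dirichlet {K : ℕ} (a : Fin K → ℝ) : Measure (Fin K → ℝ) :=
  (Measure.pi fun i => gammaMeasure (a i) 1).map fun g i => g i / ∑ l, g l

/-- `D(t) = Γ(t_1) ⋯ Γ(t_K) / Γ(t_1 + ⋯ + t_K)`. -/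
def dirichletD {K : ℕ} (t : Fin K → ℝ) : ℝ :=
  (∏ i, Real.Gamma (t i)) / Real.Gamma (∑ i, t i)

theorem isProbabilityMeasure_dirichlet {K : ℕ} {a : Fin K → ℝ} (ha : ∀ i, 0 < a i) :
    IsProbabilityMeasure (dirichlet a) := by
  have : ∀ i, IsProbabilityMeasure (gammaMeasure (a i) 1) := fun i =>
    isProbabilityMeasure_gammaMeasure (ha i) one_pos
  unfold dirichlet
  refine Measure.isProbabilityMeasure_map (Measurable.aemeasurable ?_)
  fun_prop

/-- Convergence in variational distance. -/
def TendstoInVariation {Ω : Type*} [MeasurableSpace Ω] (Q' : ℕ → Measure Ω) (Q : Measure Ω) :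
    Prop :=
  TendstoUniformlyOn (fun k B => (Q' k).real B) (fun B => Q.real B) Filter.atTop
    {B | MeasurableSet B}

/-- The kernel that sends a probability measure `Q` to the law `Q^n` of `n` independent
observations from `Q`. -/
def iidKernel {Ω : Type*} [MeasurableSpace Ω] (n : ℕ) :
    Kernel (ProbabilityMeasure Ω) (Fin n → Ω) where
  toFun Q := Measure.pi fun _ => (Q : Measure Ω)
  measurable' := by
    refine Measurable.measure_of_isPiSystem_of_isProbabilityMeasure
      (S := Set.pi Set.univ '' Set.pi Set.univ fun _ : Fin n => {s : Set Ω | MeasurableSet s})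
      generateFrom_pi.symm isPiSystem_pi ?_
    rintro _ ⟨s, hs, rfl⟩
    simp only [Measure.pi_pi]
    exact Finset.measurable_prod _ fun i _ =>
      (Measure.measurable_coe (hs i trivial)).comp measurable_subtype_coe

/-- `κ` is a regular conditional distribution (the posterior) of `Q` given `X = x`, when `Q` has
law `π` and, given `Q`, `X = (X_1, …, X_n)` are independent observations from `Q`. -/
def IsPosterior {Ω : Type*} [MeasurableSpace Ω] {n : ℕ} (π : Measure (ProbabilityMeasure Ω))
    (κ : Kernel (Fin n → Ω) (ProbabilityMeasure Ω)) : Prop :=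
  (iidKernel n ∘ₘ π) ⊗ₘ κ = (π ⊗ₘ iidKernel n).map Prod.swap

namespace PartitionScheme

variable {Ω : Type*} [MeasurableSpace Ω] {R : Type*} {μ : Measure Ω}

/-- The parameters of an optional Pólya tree with independent stopping rule: nonrandom stopping
probabilities `ρ(A)`, selection probability vectors `λ(A)` and assignment weight vectors `α^j(A)`.
A region which cannot be partitioned is stopped with certainty. -/
structure Params (T : PartitionScheme R μ) where
  /-- the stopping probability `ρ(A)` -/
  rho : R → ℝ
  /-- the selection probabilities `λ_j(A)` -/
  lam : ∀ A, Fin (T.ways A) → ℝ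
  /-- the assignment weights `α_i^j(A)` -/
  alpha : ∀ A j, Fin (T.parts A j) → ℝ
  rho_nonneg : ∀ A, 0 ≤ rho A
  rho_le_one : ∀ A, rho A ≤ 1
  rho_eq_one : ∀ A, T.ways A = 0 → rho A = 1
  lam_nonneg : ∀ A j, 0 ≤ lam A j
  sum_lam : ∀ A, T.ways A ≠ 0 → ∑ j, lam A j = 1
  alpha_pos : ∀ A j i, 0 < alpha A j i

/-- The random variables attached to `A`: the decision taken at `A`, and for each way `j` to
partition `A` the conditional probabilities `θ^j` of the parts. -/
abbrev Node (T : PartitionScheme R μ) (A : R) : Type :=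
  Decision (T.ways A) × (∀ j : Fin (T.ways A), Fin (T.parts A j) → ℝ)

/-- All random variables used in the construction. The parts of a partition are disjoint and
strictly smaller, so that no region occurs twice in a recursive partition, and one family of
independent variables indexed by the regions suffices. -/
abbrev Config (T : PartitionScheme R μ) : Type _ := ∀ A, T.Node A

variable {T : PartitionScheme R μ}

/-- Stop with probability `ρ(A)`, otherwise choose the `j`-th partition with probability
`λ_j(A)`. -/
def Params.decisionLaw (P : T.Params) (A : R) : Measure (Decision (T.ways A)) :=
  ENNReal.ofReal (P.rho A) • Measure.dirac Decision.halt +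
    ENNReal.ofReal (1 - P.rho A) •
      ∑ j, ENNReal.ofReal (P.lam A j) • Measure.dirac (Decision.split j)

/-- The law of the variables attached to `A`: they are independent, and `θ^j` has the Dirichlet
distribution with parameter `α^j(A)`. -/
def Params.nodeLaw (P : T.Params) (A : R) : Measure (T.Node A) :=
  (P.decisionLaw A).prod (Measure.pi fun j => dirichlet (P.alpha A j))

instance (P : T.Params) (A : R) : IsProbabilityMeasure (P.decisionLaw A) := by
  refine ⟨?_⟩
  simp only [Params.decisionLaw, Measure.coe_add, Measure.coe_smul, Measure.coe_finsetSum,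
    Pi.add_apply, Pi.smul_apply, Finset.sum_apply, measure_univ, smul_eq_mul, mul_one]
  by_cases h : T.ways A = 0
  · simp [P.rho_eq_one A h]
  · rw [← ENNReal.ofReal_sum_of_nonneg fun j _ => P.lam_nonneg A j, P.sum_lam A h,
      ENNReal.ofReal_one, mul_one, ← ENNReal.ofReal_add (P.rho_nonneg A)
      (sub_nonneg.2 (P.rho_le_one A)), add_sub_cancel, ENNReal.ofReal_one]

instance (P : T.Params) (A : R) (j : Fin (T.ways A)) :
    IsProbabilityMeasure (dirichlet (P.alpha A j)) :=
  isProbabilityMeasure_dirichlet (P.alpha_pos A j)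

instance (P : T.Params) (A : R) : IsProbabilityMeasure (P.nodeLaw A) := by
  unfold Params.nodeLaw; infer_instance

/-- The joint law of all random variables used in the construction. -/
def Params.law (P : T.Params) : Measure T.Config := Measure.infinitePi P.nodeLaw

/-- The random measure obtained when the recursive construction is started at `A` and carried out
for `k` steps: it is uniform on each region of the resulting partition of `A`. Started at the whole
space, this is `Q^{(k)}`. -/
def partialMeasure (T : PartitionScheme R μ) (ω : T.Config) : ℕ → R → Measure Ω
  | 0, A => cond μ (T.toSet A)
  | k + 1, A =>
    match (ω A).1 with
    | .halt => cond μ (T.toSet A)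
    | .split j => ∑ i, ENNReal.ofReal ((ω A).2 j i) • T.partialMeasure ω k (T.part A j i)

/-- `π` is an optional Pólya tree distribution with the given parameters: with probability one
`Q^{(k)}` converges in variational distance to a random probability measure `Q`, of law `π`. -/
def IsOptionalPolyaTree (T : PartitionScheme R μ) (P : T.Params)
    (π : Measure (ProbabilityMeasure Ω)) : Prop :=
  ∃ Q : T.Config → ProbabilityMeasure Ω, Measurable Q ∧
    (∀ᵐ ω ∂P.law, TendstoInVariation (fun k => T.partialMeasure ω k T.root) (Q ω)) ∧
    π = P.law.map Q

/-- The density of `T.partialMeasure ω k A`, restricted to the part of `A` on which the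
partitioning has been stopped during the `k` steps. -/
def stoppedDensity (T : PartitionScheme R μ) (ω : T.Config) : ℕ → R → Ω → ℝ≥0∞
  | 0, _, _ => 0
  | k + 1, A, x =>
    match (ω A).1 with
    | .halt => (T.toSet A).indicator (fun _ => (μ (T.toSet A))⁻¹) x
    | .split j => ∑ i, ENNReal.ofReal ((ω A).2 j i) * T.stoppedDensity ω k (T.part A j i) x

/-- The conditional density `q(· | A)` of the random measure, that is, the density of the optional
Pólya tree induced within `A`: the (eventually constant, increasing) limit of the densities on the
stopped parts. -/
def density (T : PartitionScheme R μ) (ω : T.Config) (A : R) (x : Ω) : ℝ≥0∞ :=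
  ⨆ k, T.stoppedDensity ω k A x

open Classical in
/-- The indices of the observations that fall into `A`. -/
def obs (T : PartitionScheme R μ) {n : ℕ} (x : Fin n → Ω) (A : R) : Finset (Fin n) :=
  Finset.univ.filter fun l => x l ∈ T.toSet A

/-- The vector `n^j` of the numbers of observations in the parts of the `j`-th partition of `A`. -/
def counts (T : PartitionScheme R μ) {n : ℕ} (x : Fin n → Ω) (A : R) (j : Fin (T.ways A))
    (i : Fin (T.parts A j)) : ℝ :=
  ((T.obs x (T.part A j i)).card : ℝ)

/-- `Φ₀(A)`: the likelihood of the observations in `A` under the uniform distribution on `A`. -/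
def uniformLikelihood (T : PartitionScheme R μ) {n : ℕ} (x : Fin n → Ω) (A : R) : ℝ≥0∞ :=
  ∏ _l ∈ T.obs x A, (μ (T.toSet A))⁻¹

/-- `Φ(A)`: the marginal likelihood of the observations in `A`, the expectation of
`∏_{x_l ∈ A} q(x_l | A)` under the optional Pólya tree induced within `A`. -/
def Params.marginalLikelihood (P : T.Params) {n : ℕ} (x : Fin n → Ω) (A : R) : ℝ≥0∞ :=
  ∫⁻ ω, ∏ l ∈ T.obs x A, T.density ω A (x l) ∂P.law

/-- `λ_j · D(n^j + α^j) / D(α^j) · ∏_i Φ(A_i^j)`. -/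
def Params.selWeight (P : T.Params) {n : ℕ} (x : Fin n → Ω) (A : R) (j : Fin (T.ways A)) : ℝ≥0∞ :=
  ENNReal.ofReal (P.lam A j) *
    ENNReal.ofReal (dirichletD (T.counts x A j + P.alpha A j) / dirichletD (P.alpha A j)) *
    ∏ i, P.marginalLikelihood x (T.part A j i)

end PartitionScheme

end OptionalPolya

end

noncomputable section

namespace OptionalPolya

/-! Everything rests on a self-similarity. Once the decision and the weights at `A` are known, the
random density within `A` is either uniform or a `θ`-mixture of densities within the parts. The
parts are disjoint and nonempty, so the subtrees below them use disjoint sets of independent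
variables. A likelihood within `A` therefore factorises: `θ_i` enters with the power `n(A_i)`, times
the likelihoods within the parts. Independence and the Dirichlet moment `E ∏ θ_i ^ n_i = D(n + α) /
D(α)` give a one-step formula, `lintegral_law_elim_prod`. Applied to the likelihood itself, it is
the recursion for `Φ`.

The prior density has mass one because each step multiplies the expected unstopped mass by at most
`1 - δ`. Both `Q^(k)` and the limit dominate the part stopped so far, so their variational distance
is at most the mass that part lacks.

For the posterior, write `L_x` for the likelihood of `x`. Reweighting the prior by `L_x` certainly
gives a regular conditional distribution; the point is that it is an optional Pólya tree. This
follows from the identity `E[L_x L_y] = Φ_x · E'[L_y]` for arbitrary further points `y`, where `E'`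
is expectation under the candidate parameters (`lintegral_likelihood_mul_likelihood`). It is proved
by induction on the depth to which `y` is resolved: both sides obey the one-step formula, and the
coefficients agree by the recursion for `Φ` and by telescoping ratios of `D`. Integrating over `y`
in `B_1 × ⋯ × B_m` shows that the reweighted prior and the candidate tree give the same expectations
of `∏ Q(B_l)`, and such mixed moments determine the law of a random probability measure. The case `m
= 1`, `B_1 = Ω` also yields that the candidate density has mass one almost surely, with no lower
bound on its stopping probabilities. -/

/-! ### Integrals over finite products -/

theorem lintegral_pi_prod {α : Type*} [MeasurableSpace α] {n : ℕ} (μ : Fin n → Measure α)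
    [∀ i, SigmaFinite (μ i)] {f : Fin n → α → ℝ≥0∞} (hf : ∀ i, Measurable (f i)) :
    ∫⁻ x, ∏ i, f i (x i) ∂Measure.pi μ = ∏ i, ∫⁻ x, f i x ∂μ i := by
  induction n with
  | zero => simp
  | succ n ih =>
    have h := (measurePreserving_piFinSuccAbove μ 0).symm
    rw [← h.lintegral_comp_emb (MeasurableEquiv.measurableEmbedding _)]
    simp only [MeasurableEquiv.piFinSuccAbove_symm_apply, Fin.insertNthEquiv_apply,
      Fin.prod_univ_succ, Fin.insertNth_zero', Fin.cons_zero, Fin.cons_succ]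
    rw [lintegral_prod_mul (f := f 0) (g := fun y : Fin n → α => ∏ i, f i.succ (y i))
      (hf 0).aemeasurable
      (Finset.measurable_prod _ fun i _ => (hf i.succ).comp (measurable_pi_apply i)).aemeasurable]
    congr 1
    exact ih _ fun i => hf i.succ

theorem setLIntegral_pi_prod {α : Type*} [MeasurableSpace α] {n : ℕ} (μ : Fin n → Measure α)
    [∀ i, SigmaFinite (μ i)] {f : Fin n → α → ℝ≥0∞} (hf : ∀ i, Measurable (f i))
    (s : Fin n → Set α) :
    ∫⁻ x in Set.univ.pi s, ∏ i, f i (x i) ∂Measure.pi μ = ∏ i, ∫⁻ x in s i, f i x ∂μ i := by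
  rw [Measure.restrict_pi_pi, lintegral_pi_prod _ hf]

theorem pi_withDensity {α : Type*} [MeasurableSpace α] {n : ℕ} (μ : Fin n → Measure α)
    [∀ i, SigmaFinite (μ i)] {f : Fin n → α → ℝ≥0∞} (hf : ∀ i, Measurable (f i))
    [∀ i, SigmaFinite ((μ i).withDensity (f i))] :
    Measure.pi (fun i => (μ i).withDensity (f i)) =
      (Measure.pi μ).withDensity fun x => ∏ i, f i (x i) := by
  refine Measure.pi_eq fun s hs => ?_
  rw [withDensity_apply _ (MeasurableSet.univ_pi hs), setLIntegral_pi_prod _ hf]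
  exact Finset.prod_congr rfl fun i _ => (withDensity_apply _ (hs i)).symm

/-! ### Gamma measures and Dirichlet moments -/

theorem measurable_gammaPDF (a r : ℝ) : Measurable (gammaPDF a r) :=
  (measurable_gammaPDFReal a r).ennreal_ofReal

/-- The origin is excluded because the conventions for `0 ^ p` can break the identity there; it is a
null set. -/
theorem gammaPDF_mul_rpow {a p x : ℝ} (ha : 0 < a) (hap : 0 < a + p) (hx : x ≠ 0) :
    gammaPDF a 1 x * ENNReal.ofReal (x ^ p) =
      ENNReal.ofReal (Real.Gamma (a + p) / Real.Gamma a) * gammaPDF (a + p) 1 x := by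
  rcases hx.lt_or_gt with h | h
  · simp [gammaPDF_of_neg h]
  · rw [gammaPDF_of_nonneg h.le, gammaPDF_of_nonneg h.le, ← ENNReal.ofReal_mul (by positivity),
      ← ENNReal.ofReal_mul (by positivity)]
    congr 1
    have h1 : x ^ (a + p - 1) = x ^ (a - 1) * x ^ p := by
      rw [← Real.rpow_add h]; congr 1; ring
    have := (Real.Gamma_pos_of_pos ha).ne'
    have := (Real.Gamma_pos_of_pos hap).ne'
    rw [h1, Real.one_rpow, Real.one_rpow]
    field_simp

theorem gammaMeasure_withDensity_rpow {a p : ℝ} (ha : 0 < a) (hap : 0 < a + p) :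
    (gammaMeasure a 1).withDensity (fun x => ENNReal.ofReal (x ^ p)) =
      ENNReal.ofReal (Real.Gamma (a + p) / Real.Gamma a) • gammaMeasure (a + p) 1 := by
  rw [gammaMeasure, ← withDensity_mul _ (measurable_gammaPDF _ _) (by fun_prop), gammaMeasure,
    ← withDensity_smul _ (measurable_gammaPDF _ _)]
  refine withDensity_congr_ae ?_
  filter_upwards [Measure.ae_ne volume (0 : ℝ)] with x hx
  exact gammaPDF_mul_rpow ha hap hx

theorem ae_pos_gammaMeasure (a r : ℝ) : ∀ᵐ x ∂gammaMeasure a r, 0 < x := by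
  rw [gammaMeasure, ae_withDensity_iff (measurable_gammaPDF _ _)]
  filter_upwards [Measure.ae_ne volume (0 : ℝ)] with x hx h
  by_contra hneg
  exact h (gammaPDF_of_neg (lt_of_le_of_ne (not_lt.1 hneg) hx))

/-- Tilting by `exp (-(s * x))` changes the rate from `1` to `1 + s`, up to the constant in the
result. -/
theorem lintegral_exp_gammaMeasure {a s : ℝ} (ha : 0 < a) (hs : 0 ≤ s) :
    ∫⁻ x, ENNReal.ofReal (Real.exp (-(s * x))) ∂gammaMeasure a 1 =
      ENNReal.ofReal ((1 + s) ^ (-a)) := by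
  rw [gammaMeasure, lintegral_withDensity_eq_lintegral_mul _ (measurable_gammaPDF _ _)
    (by fun_prop)]
  have h1 : ∀ x, (gammaPDF a 1 * fun x => ENNReal.ofReal (Real.exp (-(s * x)))) x =
      ENNReal.ofReal ((1 + s) ^ (-a)) * gammaPDF a (1 + s) x := by
    intro x
    rcases lt_or_ge x 0 with h | h
    · simp [gammaPDF_of_neg h]
    · rw [Pi.mul_apply, gammaPDF_of_nonneg h, gammaPDF_of_nonneg h,
        ← ENNReal.ofReal_mul (by positivity), ← ENNReal.ofReal_mul (by positivity)]
      congr 1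
      have e1 : Real.exp (-((1 + s) * x)) = Real.exp (-(1 * x)) * Real.exp (-(s * x)) := by
        rw [← Real.exp_add]; congr 1; ring
      have e2 : (1 + s) ^ (-a) * (1 + s) ^ a = 1 := by
        rw [← Real.rpow_add (by positivity)]; simp
      rw [e1, Real.one_rpow]
      linear_combination (-(1 / Real.Gamma a * x ^ (a - 1) * Real.exp (-(1 * x)) *
        Real.exp (-(s * x)))) * e2
  simp_rw [h1]
  rw [lintegral_const_mul _ (measurable_gammaPDF _ _), lintegral_gammaPDF_eq_one ha (by positivity),
    mul_one]

/-- The weight with which `x ^ (-p)` is a mixture of the exponentials `exp (-(x * s))`. -/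
def mixWeight (p s : ℝ) : ℝ≥0∞ :=
  ENNReal.ofReal (if 0 ≤ s then s ^ (p - 1) / Real.Gamma p else 0)

theorem measurable_mixWeight (p : ℝ) : Measurable (mixWeight p) :=
  (Measurable.ite measurableSet_Ici (by fun_prop) measurable_const).ennreal_ofReal

theorem lintegral_mixWeight_mul_exp {p x : ℝ} (hp : 0 < p) (hx : 0 < x) :
    ∫⁻ s, mixWeight p s * ENNReal.ofReal (Real.exp (-(s * x))) = ENNReal.ofReal (x ^ (-p)) := by
  have h1 : ∀ s, mixWeight p s * ENNReal.ofReal (Real.exp (-(s * x))) =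
      ENNReal.ofReal (x ^ (-p)) * gammaPDF p x s := by
    intro s
    rcases lt_or_ge s 0 with h | h
    · simp [gammaPDF_of_neg h, mixWeight, not_le.2 h]
    · rw [gammaPDF_of_nonneg h, mixWeight, if_pos h, ← ENNReal.ofReal_mul (by positivity),
        ← ENNReal.ofReal_mul (by positivity)]
      congr 1
      have e2 : x ^ (-p) * x ^ p = 1 := by
        rw [← Real.rpow_add (by positivity)]; simp
      rw [mul_comm s x]
      linear_combination (-(1 / Real.Gamma p * s ^ (p - 1) * Real.exp (-(x * s)))) * e2
  simp_rw [h1]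
  rw [lintegral_const_mul _ (measurable_gammaPDF _ _), lintegral_gammaPDF_eq_one hp hx, mul_one]

/-- Writing the negative power as a mixture of exponentials makes the integrand factorise over the
coordinates. The right side depends on `b` only through its sum, which replaces the fact that a sum
of independent gamma variables is gamma. -/
theorem lintegral_rpow_neg_sum {K : ℕ} [NeZero K] {b : Fin K → ℝ} (hb : ∀ i, 0 < b i) {p : ℝ}
    (hp : 0 < p) :
    ∫⁻ g, ENNReal.ofReal ((∑ i, g i) ^ (-p)) ∂Measure.pi (fun i => gammaMeasure (b i) 1) =
      ∫⁻ s, mixWeight p s * ENNReal.ofReal ((1 + s) ^ (-∑ i, b i)) := by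
  have hprob : ∀ i, IsProbabilityMeasure (gammaMeasure (b i) 1) := fun i =>
    isProbabilityMeasure_gammaMeasure (hb i) one_pos
  have hpos : ∀ᵐ g ∂Measure.pi (fun i => gammaMeasure (b i) 1), ∀ i, 0 < g i :=
    ae_all_iff.2 fun i => (measurePreserving_eval (fun i => gammaMeasure (b i) 1)
      i).quasiMeasurePreserving.ae (ae_pos_gammaMeasure _ _)
  have hm := measurable_mixWeight p
  calc _ = ∫⁻ g, (∫⁻ s, mixWeight p s * ENNReal.ofReal (Real.exp (-(s * ∑ i, g i))))
        ∂Measure.pi (fun i => gammaMeasure (b i) 1) := by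
        refine lintegral_congr_ae ?_
        filter_upwards [hpos] with g hg
        exact (lintegral_mixWeight_mul_exp hp
          (Finset.sum_pos (fun i _ => hg i) Finset.univ_nonempty)).symm
    _ = ∫⁻ s, (∫⁻ g, mixWeight p s * ENNReal.ofReal (Real.exp (-(s * ∑ i, g i)))
        ∂Measure.pi (fun i => gammaMeasure (b i) 1)) := by
        refine lintegral_lintegral_swap (Measurable.aemeasurable ?_)
        unfold Function.uncurry
        fun_prop
    _ = _ := by
        refine lintegral_congr fun s => ?_
        rcases lt_or_ge s 0 with h | h
        · simp [mixWeight, not_le.2 h]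
        rw [lintegral_const_mul _ (by fun_prop)]
        congr 1
        have h1 : ∀ g : Fin K → ℝ, ENNReal.ofReal (Real.exp (-(s * ∑ i, g i))) =
            ∏ i, ENNReal.ofReal (Real.exp (-(s * g i))) := fun g => by
          rw [← ENNReal.ofReal_prod_of_nonneg fun i _ => (Real.exp_pos _).le, ← Real.exp_sum,
            Finset.sum_neg_distrib, Finset.mul_sum]
        simp_rw [h1]
        rw [lintegral_pi_prod (fun i => gammaMeasure (b i) 1)
          (f := fun _ x => ENNReal.ofReal (Real.exp (-(s * x)))) (fun i => by fun_prop)]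
        simp_rw [lintegral_exp_gammaMeasure (hb _) h]
        rw [← ENNReal.ofReal_prod_of_nonneg fun i _ => by positivity, ← Finset.sum_neg_distrib,
          Real.rpow_sum_of_pos (by positivity)]

/-- By the previous formula the vector may be replaced by one gamma variable with parameter `∑ i, b
i`, whose negative moment is a ratio of Gamma values. -/
theorem lintegral_rpow_neg_sum_eq {K : ℕ} [NeZero K] {b : Fin K → ℝ} (hb : ∀ i, 0 < b i) {p : ℝ}
    (hp : 0 < p) (hpb : p < ∑ i, b i) :
    ∫⁻ g, ENNReal.ofReal ((∑ i, g i) ^ (-p)) ∂Measure.pi (fun i => gammaMeasure (b i) 1) =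
      ENNReal.ofReal (Real.Gamma (∑ i, b i - p) / Real.Gamma (∑ i, b i)) := by
  have hB : 0 < ∑ i, b i := hp.trans hpb
  have h1 := lintegral_rpow_neg_sum (K := 1) (b := fun _ => ∑ i, b i) (fun _ => hB) hp
  have hprob := isProbabilityMeasure_gammaMeasure hB one_pos
  have hprob' := isProbabilityMeasure_gammaMeasure (sub_pos.2 hpb) one_pos
  rw [lintegral_rpow_neg_sum hb hp]
  simp only [Fin.sum_univ_one] at h1
  rw [← h1, (measurePreserving_eval (fun _ : Fin 1 => gammaMeasure (∑ i, b i) 1) 0).lintegral_comp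
    (f := fun x => ENNReal.ofReal (x ^ (-p))) (by fun_prop), ← setLIntegral_univ,
    ← withDensity_apply _ MeasurableSet.univ, gammaMeasure_withDensity_rpow hB (by linarith),
    ← sub_eq_add_neg]
  simp

theorem dirichletD_pos {K : ℕ} [NeZero K] {t : Fin K → ℝ} (ht : ∀ i, 0 < t i) :
    0 < dirichletD t :=
  div_pos (Finset.prod_pos fun i _ => Real.Gamma_pos_of_pos (ht i))
    (Real.Gamma_pos_of_pos (Finset.sum_pos (fun i _ => ht i) Finset.univ_nonempty))

/-- The factors `g i ^ n i` tilt each gamma variable from `a i` to `a i + n i`, at the cost of a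
Gamma ratio. What remains is the moment of order `-N` of the sum under the tilted law, so no
Dirichlet density is needed. -/
theorem lintegral_dirichlet_prod_pow {K : ℕ} [NeZero K] {a : Fin K → ℝ} (ha : ∀ i, 0 < a i)
    (n : Fin K → ℕ) :
    ∫⁻ θ, ∏ i, ENNReal.ofReal (θ i) ^ n i ∂dirichlet a =
      ENNReal.ofReal (dirichletD ((fun i => (n i : ℝ)) + a) / dirichletD a) := by
  have hprob : ∀ i, IsProbabilityMeasure (gammaMeasure (a i) 1) := fun i =>
    isProbabilityMeasure_gammaMeasure (ha i) one_pos
  have hprobD := isProbabilityMeasure_dirichlet ha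
  have hb : ∀ i, 0 < a i + (n i : ℝ) := fun i => add_pos_of_pos_of_nonneg (ha i) (by positivity)
  have hprob' : ∀ i, IsProbabilityMeasure (gammaMeasure (a i + (n i : ℝ)) 1) := fun i =>
    isProbabilityMeasure_gammaMeasure (hb i) one_pos
  -- The negative moment formula needs a positive exponent, so `N = 0` is separate.
  rcases Nat.eq_zero_or_pos (∑ i, n i) with h0 | hN
  · have h0' : ∀ i, n i = 0 := by simpa using h0
    have h1 : ((fun i => (n i : ℝ)) + a) = a := by ext i; simp [h0']
    rw [h1, div_self (dirichletD_pos ha).ne']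
    simp [h0']
  set N := ∑ i, n i with hNdef
  have hpos : ∀ᵐ g ∂Measure.pi (fun i => gammaMeasure (a i) 1), ∀ i, 0 < g i :=
    ae_all_iff.2 fun i => (measurePreserving_eval (fun i => gammaMeasure (a i) 1)
      i).quasiMeasurePreserving.ae (ae_pos_gammaMeasure _ _)
  have hsum : ∑ i, (a i + (n i : ℝ)) = ∑ i, a i + N := by
    rw [Finset.sum_add_distrib, hNdef, Nat.cast_sum]
  have hA : 0 < ∑ i, a i := Finset.sum_pos (fun i _ => ha i) Finset.univ_nonempty
  have hN' : (0 : ℝ) < N := by exact_mod_cast hN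
  rw [dirichlet, lintegral_map (by fun_prop) (by fun_prop)]
  calc _ = ∫⁻ g, ENNReal.ofReal ((∑ i, g i) ^ (-(N : ℝ)))
        ∂(Measure.pi (fun i => gammaMeasure (a i) 1)).withDensity
          (fun g => ∏ i, ENNReal.ofReal (g i ^ (n i : ℝ))) := by
        rw [lintegral_withDensity_eq_lintegral_mul _ (by fun_prop) (by fun_prop)]
        refine lintegral_congr_ae ?_
        filter_upwards [hpos] with g hg
        have hG : 0 < ∑ i, g i := Finset.sum_pos (fun i _ => hg i) Finset.univ_nonempty
        have e1 : ∀ i, ENNReal.ofReal (g i / ∑ l, g l) ^ n i =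
            ENNReal.ofReal (g i ^ (n i : ℝ) * ((∑ l, g l) ^ n i)⁻¹) := fun i => by
          rw [← ENNReal.ofReal_pow (div_pos (hg i) hG).le, div_pow, Real.rpow_natCast,
            div_eq_mul_inv]
        simp_rw [e1]
        rw [Pi.mul_apply, ← ENNReal.ofReal_prod_of_nonneg fun i _ => by have := hg i; positivity,
          ← ENNReal.ofReal_prod_of_nonneg fun i _ => by have := hg i; positivity,
          ← ENNReal.ofReal_mul (Finset.prod_nonneg fun i _ => by have := hg i; positivity),
          Finset.prod_mul_distrib, Finset.prod_inv_distrib, Finset.prod_pow_eq_pow_sum,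
          Real.rpow_neg hG.le, Real.rpow_natCast]
    _ = (∏ i, ENNReal.ofReal (Real.Gamma (a i + n i) / Real.Gamma (a i))) *
        ENNReal.ofReal (Real.Gamma (∑ i, a i) / Real.Gamma (∑ i, a i + N)) := by
        have e2 : (Measure.pi (fun i => gammaMeasure (a i) 1)).withDensity
            (fun g => ∏ i, ENNReal.ofReal (g i ^ (n i : ℝ))) =
            (∏ i, ENNReal.ofReal (Real.Gamma (a i + n i) / Real.Gamma (a i))) •
              Measure.pi (fun i => gammaMeasure (a i + n i) 1) := by
          have hfin : ∀ i, SigmaFinite ((gammaMeasure (a i) 1).withDensity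
              fun x => ENNReal.ofReal (x ^ (n i : ℝ))) := fun i =>
            SigmaFinite.withDensity_ofReal _
          rw [← pi_withDensity (fun i => gammaMeasure (a i) 1)
            (f := fun i x => ENNReal.ofReal (x ^ (n i : ℝ))) (fun i => by fun_prop)]
          refine Measure.pi_eq fun s hs => ?_
          simp only [gammaMeasure_withDensity_rpow (ha _) (hb _)]
          simp [Measure.pi_pi, Finset.prod_mul_distrib]
        rw [e2, lintegral_smul_measure, lintegral_rpow_neg_sum_eq hb hN' (by rw [hsum]; linarith),
          hsum, add_sub_cancel_right, smul_eq_mul]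
    _ = _ := by
        rw [← ENNReal.ofReal_prod_of_nonneg fun i _ => (div_pos (Real.Gamma_pos_of_pos (hb i))
            (Real.Gamma_pos_of_pos (ha i))).le, ← ENNReal.ofReal_mul
            (Finset.prod_nonneg fun i _ => (div_pos (Real.Gamma_pos_of_pos (hb i))
            (Real.Gamma_pos_of_pos (ha i))).le), Finset.prod_div_distrib, dirichletD, dirichletD]
        congr 1
        simp only [Pi.add_apply, add_comm _ (a _), hsum]
        rw [div_div_div_eq, div_mul_div_comm]
        congr 1
        ring

theorem ae_dirichlet_sum_eq_one {K : ℕ} [NeZero K] {a : Fin K → ℝ} (ha : ∀ i, 0 < a i) :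
    ∀ᵐ θ ∂dirichlet a, ∑ i, ENNReal.ofReal (θ i) = 1 := by
  have hprob : ∀ i, IsProbabilityMeasure (gammaMeasure (a i) 1) := fun i =>
    isProbabilityMeasure_gammaMeasure (ha i) one_pos
  have hpos : ∀ᵐ g ∂Measure.pi (fun i => gammaMeasure (a i) 1), ∀ i, 0 < g i :=
    ae_all_iff.2 fun i => (measurePreserving_eval (fun i => gammaMeasure (a i) 1)
      i).quasiMeasurePreserving.ae (ae_pos_gammaMeasure _ _)
  rw [dirichlet, ae_map_iff (by fun_prop) (measurableSet_eq_fun (by fun_prop) (by fun_prop))]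
  filter_upwards [hpos] with g hg
  have hG : 0 < ∑ i, g i := Finset.sum_pos (fun i _ => hg i) Finset.univ_nonempty
  rw [← ENNReal.ofReal_sum_of_nonneg fun i _ => (div_pos (hg i) hG).le, ← Finset.sum_div,
    div_self hG.ne', ENNReal.ofReal_one]

/-! ### Independence in infinite products -/

section Product

variable {ι : Type*} {X : ι → Type*}

open Classical in
/-- The configuration that agrees with `p.1` on `S` and with `p.2` outside `S`. -/
def merge (S : Set ι) (p : (∀ i, X i) × (∀ i, X i)) (i : ι) : X i :=
  if i ∈ S then p.1 i else p.2 i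

theorem merge_of_mem {S : Set ι} {i : ι} (hi : i ∈ S) (p : (∀ i, X i) × (∀ i, X i)) :
    merge S p i = p.1 i := if_pos hi

theorem merge_of_notMem {S : Set ι} {i : ι} (hi : i ∉ S) (p : (∀ i, X i) × (∀ i, X i)) :
    merge S p i = p.2 i := if_neg hi

variable [∀ i, MeasurableSpace (X i)]

theorem measurable_merge (S : Set ι) : Measurable (merge (X := X) S) := by
  refine measurable_pi_lambda _ fun i => ?_
  by_cases hi : i ∈ S
  · simp only [merge_of_mem hi]; fun_prop
  · simp only [merge_of_notMem hi]; fun_prop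

variable (m : ∀ i, Measure (X i)) [∀ i, IsProbabilityMeasure (m i)]

/-- On boxes the factors split into those with index in `S` and those outside. Splicing two
independent copies thus expresses independence of the two groups of coordinates without restricting
the product to `S`. -/
theorem map_merge (S : Set ι) :
    ((Measure.infinitePi m).prod (Measure.infinitePi m)).map (merge S) = Measure.infinitePi m := by
  classical
  refine Measure.eq_infinitePi _ fun s t ht => ?_
  have h1 : merge S ⁻¹' (Set.pi s t) =
      (Set.pi (s.filter (· ∈ S)) t) ×ˢ (Set.pi (s.filter (· ∉ S)) t) := by
    ext p
    simp only [Set.mem_preimage, Set.mem_pi, Set.mem_prod, Finset.coe_filter, Set.mem_ofPred_eq,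
      Finset.mem_coe]
    constructor
    · intro h
      exact ⟨fun i hi => merge_of_mem hi.2 p ▸ h i hi.1,
        fun i hi => merge_of_notMem hi.2 p ▸ h i hi.1⟩
    · rintro ⟨h, h'⟩ i hi
      by_cases hS : i ∈ S
      · rw [merge_of_mem hS]; exact h i ⟨hi, hS⟩
      · rw [merge_of_notMem hS]; exact h' i ⟨hi, hS⟩
  rw [Measure.map_apply (measurable_merge S)
    (MeasurableSet.pi s.countable_toSet fun i _ => ht i), h1, Measure.prod_prod,
    Measure.infinitePi_pi _ (fun i _ => ht i), Measure.infinitePi_pi _ (fun i _ => ht i),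
    Finset.prod_filter_mul_prod_filter_not]

theorem lintegral_infinitePi_merge (S : Set ι) {f : (∀ i, X i) → ℝ≥0∞} (hf : Measurable f) :
    ∫⁻ ω, f ω ∂Measure.infinitePi m =
      ∫⁻ ω, ∫⁻ ω', f (merge S (ω, ω')) ∂Measure.infinitePi m ∂Measure.infinitePi m := by
  conv_lhs => rw [← map_merge m S, lintegral_map hf (measurable_merge S)]
  exact lintegral_prod _ (hf.comp (measurable_merge S)).aemeasurable

/-- After splicing along `S`, `f` sees only the first copy and `g` only the second. -/
theorem lintegral_infinitePi_mul {S S' : Set ι} (hS : Disjoint S S')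
    {f g : (∀ i, X i) → ℝ≥0∞} (hf : Measurable f) (hg : Measurable g) (hfS : DependsOn f S)
    (hgS : DependsOn g S') :
    ∫⁻ ω, f ω * g ω ∂Measure.infinitePi m =
      (∫⁻ ω, f ω ∂Measure.infinitePi m) * ∫⁻ ω, g ω ∂Measure.infinitePi m := by
  rw [lintegral_infinitePi_merge m S (f := fun ω => f ω * g ω) (hf.mul hg)]
  have h1 : ∀ ω ω', f (merge S (ω, ω')) * g (merge S (ω, ω')) = f ω * g ω' := fun ω ω' => by
    rw [hfS (x := merge S (ω, ω')) (y := ω) fun i hi => merge_of_mem hi _,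
      hgS (x := merge S (ω, ω')) (y := ω') fun i hi =>
        merge_of_notMem (Set.disjoint_right.1 hS hi) _]
  simp_rw [h1, lintegral_const_mul _ hg]
  rw [lintegral_mul_const _ hf]

theorem lintegral_infinitePi_prod {κ : Type*} (s : Finset κ) {S : κ → Set ι}
    (hS : Pairwise fun k l => Disjoint (S k) (S l)) {f : κ → (∀ i, X i) → ℝ≥0∞}
    (hf : ∀ k, Measurable (f k)) (hfS : ∀ k, DependsOn (f k) (S k)) :
    ∫⁻ ω, ∏ k ∈ s, f k ω ∂Measure.infinitePi m =
      ∏ k ∈ s, ∫⁻ ω, f k ω ∂Measure.infinitePi m := by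
  classical
  induction s using Finset.induction_on with
  | empty => simp
  | insert k s hk ih =>
    simp_rw [Finset.prod_insert hk]
    rw [lintegral_infinitePi_mul m (S := S k) (S' := ⋃ l ∈ s, S l) ?_ (hf k)
      (Finset.measurable_prod _ fun l _ => hf l) (hfS k) ?_, ih]
    · simp only [Set.disjoint_iUnion_right]
      intro l hl
      exact hS fun h => hk (h ▸ hl)
    · intro ω ω' h
      exact Finset.prod_congr rfl fun l hl => hfS l fun i hi =>
        h i (Set.mem_biUnion (Finset.mem_coe.2 hl) hi)

/-- Coordinate `i` is independent of all others, so it can be drawn separately; this is conditioning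
on one node. -/
theorem lintegral_infinitePi_eval (i : ι) {f : X i → (∀ i, X i) → ℝ≥0∞}
    (hf : Measurable (Function.uncurry f)) (hfi : ∀ v, DependsOn (f v) {i}ᶜ) :
    ∫⁻ ω, f (ω i) ω ∂Measure.infinitePi m = ∫⁻ v, ∫⁻ ω, f v ω ∂Measure.infinitePi m ∂m i := by
  rw [lintegral_infinitePi_merge m {i} (f := fun ω => f (ω i) ω)
    (hf.comp (f := fun ω : ∀ i, X i => (ω i, ω)) (by fun_prop))]
  have h1 : ∀ ω ω', f (merge {i} (ω, ω') i) (merge {i} (ω, ω')) = f (ω i) ω' := fun ω ω' => by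
    rw [merge_of_mem (Set.mem_singleton i)]
    exact hfi _ fun l hl => merge_of_notMem hl _
  simp_rw [h1]
  exact (measurePreserving_eval_infinitePi m i).lintegral_comp
    (f := fun v => ∫⁻ ω, f v ω ∂Measure.infinitePi m) hf.lintegral_prod_right'

end Product

/-! ### Case distinction on a decision -/

namespace Decision

/-- Case distinction on a decision. -/
def elim {m : ℕ} {β : Type*} (c : β) (g : Fin m → β) : Decision m → β
  | halt => c
  | split j => g j

@[simp] theorem elim_halt {m : ℕ} {β : Type*} (c : β) (g : Fin m → β) : elim c g halt = c := rfl

@[simp] theorem elim_split {m : ℕ} {β : Type*} (c : β) (g : Fin m → β) (j : Fin m) :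
    elim c g (split j) = g j := rfl

instance (m : ℕ) : DiscreteMeasurableSpace (Decision m) := ⟨fun _ => trivial⟩

instance (m : ℕ) : Countable (Decision m) := by
  refine Function.Injective.countable (f := elim (none : Option (Fin m)) some) ?_
  rintro (_ | j) (_ | j') h <;> simp_all

theorem measurable_elim {m : ℕ} {α β : Type*} [MeasurableSpace α] [MeasurableSpace β]
    {d : α → Decision m} {c : α → β} {g : Fin m → α → β} (hd : Measurable d) (hc : Measurable c)
    (hg : ∀ j, Measurable (g j)) : Measurable fun a => (d a).elim (c a) fun j => g j a := by
  have h : Measurable fun p : Decision m × α => p.1.elim (c p.2) fun j => g j p.2 := by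
    refine measurable_from_prod_countable_right fun e => ?_
    cases e with
    | halt => exact hc
    | split j => exact hg j
  exact h.comp (hd.prodMk measurable_id)

end Decision

/-! ### Independent subtrees and the one-step formula -/

namespace PartitionScheme

variable {Ω : Type*} [MeasurableSpace Ω] {R : Type*} {μ : Measure Ω} {T : PartitionScheme R μ}

theorem neZero_parts (A : R) (j : Fin (T.ways A)) : NeZero (T.parts A j) :=
  ⟨by have := T.two_le_parts A j; omega⟩

/-- The labels of the regions contained in `A`. -/
def below (T : PartitionScheme R μ) (A : R) : Set R := {B | T.toSet B ⊆ T.toSet A}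

theorem mem_below_self (A : R) : A ∈ T.below A := subset_rfl (a := T.toSet A)

theorem toSet_part_subset (A : R) (j : Fin (T.ways A)) (i : Fin (T.parts A j)) :
    T.toSet (T.part A j i) ⊆ T.toSet A := by
  rw [← T.iUnion_part A j]
  exact Set.subset_iUnion (fun i => T.toSet (T.part A j i)) i

theorem below_part_subset (A : R) (j : Fin (T.ways A)) (i : Fin (T.parts A j)) :
    T.below (T.part A j i) ⊆ T.below A := fun _ hB => hB.trans (T.toSet_part_subset A j i)

theorem nonempty_toSet (A : R) : (T.toSet A).Nonempty :=
  nonempty_of_measure_ne_zero (T.measure_toSet_pos A).ne'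

/-- Regions are nonempty, having positive measure, so none lies in two disjoint parts. This makes
the subtrees below different parts independent. -/
theorem disjoint_below_part (A : R) (j : Fin (T.ways A)) {i i' : Fin (T.parts A j)} (h : i ≠ i') :
    Disjoint (T.below (T.part A j i)) (T.below (T.part A j i')) := by
  refine Set.disjoint_left.2 fun B hB hB' => ?_
  obtain ⟨y, hy⟩ := T.nonempty_toSet B
  exact Set.disjoint_left.1 (T.disjoint_part A j i i' h) (hB hy) (hB' hy)

/-- Some other part exists and contains a point of `A` outside the given one. Hence the variables at
`A` are never used again further down. -/
theorem notMem_below_part (A : R) (j : Fin (T.ways A)) (i : Fin (T.parts A j)) :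
    A ∉ T.below (T.part A j i) := by
  intro hA
  have := T.two_le_parts A j
  obtain ⟨i', hi'⟩ : ∃ i', i' ≠ i := by
    have : Nontrivial (Fin (T.parts A j)) := Fin.nontrivial_iff_two_le.2 this
    exact exists_ne i
  obtain ⟨y, hy⟩ := T.nonempty_toSet (T.part A j i')
  exact Set.disjoint_left.1 (T.disjoint_part A j i' i hi') hy (hA (T.toSet_part_subset A j i' hy))

theorem below_part_subset_compl (A : R) (j : Fin (T.ways A)) (i : Fin (T.parts A j)) :
    T.below (T.part A j i) ⊆ {A}ᶜ := by
  rintro B hB rfl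
  exact T.notMem_below_part B j i hB

instance (P : T.Params) : IsProbabilityMeasure P.law := by
  unfold Params.law; infer_instance

theorem Params.lintegral_decisionLaw (P : T.Params) (A : R) (f : Decision (T.ways A) → ℝ≥0∞) :
    ∫⁻ d, f d ∂P.decisionLaw A = ENNReal.ofReal (P.rho A) * f .halt +
      ENNReal.ofReal (1 - P.rho A) * ∑ j, ENNReal.ofReal (P.lam A j) * f (.split j) := by
  simp [Params.decisionLaw, lintegral_add_measure, lintegral_smul_measure]

theorem Params.lintegral_nodeLaw (P : T.Params) (A : R) (c : ℝ≥0∞)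
    {g : ∀ j : Fin (T.ways A), (Fin (T.parts A j) → ℝ) → ℝ≥0∞} (hg : ∀ j, Measurable (g j)) :
    ∫⁻ v, v.1.elim c (fun j => g j (v.2 j)) ∂P.nodeLaw A = ENNReal.ofReal (P.rho A) * c +
      ENNReal.ofReal (1 - P.rho A) * ∑ j, ENNReal.ofReal (P.lam A j) *
        ∫⁻ θ, g j θ ∂dirichlet (P.alpha A j) := by
  have hm : Measurable fun v : T.Node A => v.1.elim c (fun j => g j (v.2 j)) :=
    Decision.measurable_elim (c := fun _ : T.Node A => c) (g := fun j v => g j (v.2 j))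
      measurable_fst measurable_const fun j => (hg j).comp (by fun_prop)
  rw [Params.nodeLaw, lintegral_prod _ hm.aemeasurable, P.lintegral_decisionLaw]
  simp only [Decision.elim_halt, Decision.elim_split, lintegral_const, measure_univ, mul_one]
  congr! 4 with j
  exact (measurePreserving_eval (fun j => dirichlet (P.alpha A j)) j).lintegral_comp (hg j)

theorem Params.lintegral_law_elim (P : T.Params) (A : R) (c : ℝ≥0∞)
    {G : ∀ j : Fin (T.ways A), (Fin (T.parts A j) → ℝ) → T.Config → ℝ≥0∞}
    (hG : ∀ j, Measurable (Function.uncurry (G j)))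
    (hdep : ∀ j θ, DependsOn (G j θ) {A}ᶜ) :
    ∫⁻ ω, (ω A).1.elim c (fun j => G j ((ω A).2 j) ω) ∂P.law = ENNReal.ofReal (P.rho A) * c +
      ENNReal.ofReal (1 - P.rho A) * ∑ j, ENNReal.ofReal (P.lam A j) *
        ∫⁻ θ, ∫⁻ ω, G j θ ω ∂P.law ∂dirichlet (P.alpha A j) := by
  have h := lintegral_infinitePi_eval P.nodeLaw A
    (f := fun v ω => v.1.elim c (fun j => G j (v.2 j) ω)) ?_ ?_
  · rw [Params.law, h, ← P.lintegral_nodeLaw A c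
      (g := fun j θ => ∫⁻ ω, G j θ ω ∂Measure.infinitePi P.nodeLaw)
      fun j => (hG j).lintegral_prod_right']
    refine lintegral_congr fun v => ?_
    rcases v with ⟨_ | j, θ⟩ <;> simp
  · refine Decision.measurable_elim (d := fun p : T.Node A × T.Config => p.1.1)
      (c := fun _ => c) (g := fun j p => G j (p.1.2 j) p.2) (by fun_prop) measurable_const
      fun j => (hG j).comp (f := fun p : T.Node A × T.Config => (p.1.2 j, p.2)) (by fun_prop)
  · rintro ⟨_ | j, θ⟩ ω ω' hω
    · rfl
    · exact hdep j _ hω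

/-- Conditioning on the node at `A` leaves a Dirichlet moment times a product over independent
subtrees. The functions `V` and exponents `n` are left general because the formula is applied to
full likelihoods, stopped likelihoods and their products. -/
theorem Params.lintegral_law_elim_prod (P : T.Params) (A : R) (c : ℝ≥0∞)
    (n : ∀ j : Fin (T.ways A), Fin (T.parts A j) → ℕ) {V : R → T.Config → ℝ≥0∞}
    (hV : ∀ B, Measurable (V B)) (hdep : ∀ B, DependsOn (V B) (T.below B)) :
    ∫⁻ ω, (ω A).1.elim c (fun j => (∏ i, ENNReal.ofReal ((ω A).2 j i) ^ n j i) *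
        ∏ i, V (T.part A j i) ω) ∂P.law = ENNReal.ofReal (P.rho A) * c +
      ENNReal.ofReal (1 - P.rho A) * ∑ j, ENNReal.ofReal (P.lam A j) *
        (ENNReal.ofReal (dirichletD ((fun i => (n j i : ℝ)) + P.alpha A j) /
          dirichletD (P.alpha A j)) * ∏ i, ∫⁻ ω, V (T.part A j i) ω ∂P.law) := by
  have hm : ∀ j : Fin (T.ways A), Measurable fun ω => ∏ i, V (T.part A j i) ω := fun j =>
    Finset.measurable_prod _ fun i _ => hV _
  rw [P.lintegral_law_elim A c
    (G := fun j θ ω => (∏ i, ENNReal.ofReal (θ i) ^ n j i) * ∏ i, V (T.part A j i) ω)]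
  · congr! 4 with j
    simp_rw [lintegral_const_mul _ (hm j)]
    have := T.neZero_parts A j
    rw [lintegral_mul_const _ (by fun_prop), lintegral_dirichlet_prod_pow (P.alpha_pos A j),
      Params.law, lintegral_infinitePi_prod P.nodeLaw Finset.univ
        (S := fun i => T.below (T.part A j i)) (fun i i' h => T.disjoint_below_part A j h)
        (fun i => hV _) (fun i => hdep _)]
  · intro j
    exact Measurable.mul (by fun_prop) ((hm j).comp measurable_snd)
  · intro j θ ω ω' h
    refine congrArg _ (Finset.prod_congr rfl fun i _ => hdep _ fun B hB => ?_)
    exact h B (T.below_part_subset_compl A j i hB)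

/-! ### Recursion for the density -/

theorem stoppedDensity_succ (ω : T.Config) (k : ℕ) (A : R) (y : Ω) :
    T.stoppedDensity ω (k + 1) A y =
      (ω A).1.elim ((T.toSet A).indicator (fun _ => (μ (T.toSet A))⁻¹) y)
        fun j => ∑ i, ENNReal.ofReal ((ω A).2 j i) * T.stoppedDensity ω k (T.part A j i) y := by
  rw [stoppedDensity]
  cases (ω A).1 <;> rfl

theorem measurable_stoppedDensity (k : ℕ) (A : R) :
    Measurable fun p : T.Config × Ω => T.stoppedDensity p.1 k A p.2 := by
  induction k generalizing A with
  | zero => exact measurable_const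
  | succ k ih =>
    simp_rw [stoppedDensity_succ]
    refine Decision.measurable_elim (d := fun p : T.Config × Ω => (p.1 A).1)
      (c := fun p => (T.toSet A).indicator (fun _ => (μ (T.toSet A))⁻¹) p.2)
      (g := fun j p => ∑ i, ENNReal.ofReal ((p.1 A).2 j i) *
        T.stoppedDensity p.1 k (T.part A j i) p.2) (by fun_prop) ?_ ?_
    · exact (measurable_const.indicator (T.measurableSet_toSet A)).comp measurable_snd
    · intro j
      exact Finset.measurable_sum _ fun i _ => Measurable.mul (by fun_prop) (ih _)

theorem dependsOn_stoppedDensity (k : ℕ) (A : R) (y : Ω) :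
    DependsOn (fun ω : T.Config => T.stoppedDensity ω k A y) (T.below A) := by
  induction k generalizing A with
  | zero => intro ω ω' _; rfl
  | succ k ih =>
    intro ω ω' h
    simp only [stoppedDensity_succ]
    rw [h A (T.mem_below_self A)]
    congr 1
    funext j
    refine Finset.sum_congr rfl fun i _ => congrArg _ (ih _ fun B hB => ?_)
    exact h B (T.below_part_subset A j i hB)

theorem stoppedDensity_of_notMem (ω : T.Config) (k : ℕ) {A : R} {y : Ω} (hy : y ∉ T.toSet A) :
    T.stoppedDensity ω k A y = 0 := by
  induction k generalizing A with
  | zero => rfl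
  | succ k ih =>
    rw [stoppedDensity_succ]
    cases (ω A).1 with
    | halt => simp [hy]
    | split j =>
      exact Finset.sum_eq_zero fun i _ => by
        rw [ih fun h => hy (T.toSet_part_subset A j i h), mul_zero]

theorem monotone_stoppedDensity (ω : T.Config) (A : R) (y : Ω) :
    Monotone fun k => T.stoppedDensity ω k A y := by
  refine monotone_nat_of_le_succ fun k => ?_
  induction k generalizing A with
  | zero => exact zero_le
  | succ k ih =>
    rw [stoppedDensity_succ, stoppedDensity_succ]
    cases (ω A).1 with
    | halt => exact le_rfl
    | split j => exact Finset.sum_le_sum fun i _ => by gcongr; exact ih _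

/-- Monotonicity in `k` lets the supremum pass through the finite sum, so the limit inherits the
recursion of its approximations. -/
theorem density_eq (ω : T.Config) (A : R) (y : Ω) :
    T.density ω A y = (ω A).1.elim ((T.toSet A).indicator (fun _ => (μ (T.toSet A))⁻¹) y)
      fun j => ∑ i, ENNReal.ofReal ((ω A).2 j i) * T.density ω (T.part A j i) y := by
  have h : T.density ω A y = ⨆ k, T.stoppedDensity ω (k + 1) A y :=
    ((T.monotone_stoppedDensity ω A y).iSup_nat_add 1).symm
  rw [h]
  simp only [stoppedDensity_succ]
  cases (ω A).1 with
  | halt => simp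
  | split j =>
    simp only [Decision.elim_split, density, ENNReal.mul_iSup]
    refine (ENNReal.finsetSum_iSup_of_monotone fun i => ?_).symm
    exact fun k k' hk => by gcongr; exact T.monotone_stoppedDensity ω _ y hk

theorem measurable_density (A : R) :
    Measurable fun p : T.Config × Ω => T.density p.1 A p.2 :=
  Measurable.iSup fun k => T.measurable_stoppedDensity k A

theorem dependsOn_density (A : R) (y : Ω) :
    DependsOn (fun ω : T.Config => T.density ω A y) (T.below A) := fun _ _ h =>
  iSup_congr fun k => T.dependsOn_stoppedDensity k A y h

theorem density_of_notMem (ω : T.Config) {A : R} {y : Ω} (hy : y ∉ T.toSet A) :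
    T.density ω A y = 0 := by
  simp [density, T.stoppedDensity_of_notMem ω _ hy]

/-! ### Recursion for the likelihood and for `Φ` -/

section Likelihood

variable {n : ℕ}

theorem mem_obs {x : Fin n → Ω} {A : R} {l : Fin n} : l ∈ T.obs x A ↔ x l ∈ T.toSet A := by
  simp [obs]

theorem obs_root (x : Fin n → Ω) : T.obs x T.root = Finset.univ := by
  ext l; simp [mem_obs, T.toSet_root]

theorem prod_obs_eq (x : Fin n → Ω) (A : R) (j : Fin (T.ways A)) (f : Fin n → ℝ≥0∞) :
    ∏ l ∈ T.obs x A, f l = ∏ i, ∏ l ∈ T.obs x (T.part A j i), f l := by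
  classical
  rw [← Finset.prod_biUnion]
  · congr 1
    ext l
    simp [mem_obs, ← T.iUnion_part A j]
  · intro i _ i' _ h
    refine Finset.disjoint_left.2 fun l hl hl' => ?_
    exact Set.disjoint_left.1 (T.disjoint_part A j i i' h) (mem_obs.1 hl) (mem_obs.1 hl')

/-- Each observation in `A` lies in exactly one part, so only one term of its sum survives; grouping
the observations by parts collects the powers of `θ i`. -/
theorem prod_obs_sum (x : Fin n → Ω) (A : R) (j : Fin (T.ways A)) (θ : Fin (T.parts A j) → ℝ≥0∞)
    {q : R → Ω → ℝ≥0∞} (hq : ∀ B y, y ∉ T.toSet B → q B y = 0) :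
    ∏ l ∈ T.obs x A, ∑ i, θ i * q (T.part A j i) (x l) =
      (∏ i, θ i ^ (T.obs x (T.part A j i)).card) *
        ∏ i, ∏ l ∈ T.obs x (T.part A j i), q (T.part A j i) (x l) := by
  rw [T.prod_obs_eq x A j, ← Finset.prod_mul_distrib]
  refine Finset.prod_congr rfl fun i _ => ?_
  rw [← Finset.prod_const, ← Finset.prod_mul_distrib]
  refine Finset.prod_congr rfl fun l hl => Finset.sum_eq_single i (fun i' _ hi' => ?_) (by simp)
  rw [hq _ _ (Set.disjoint_right.1 (T.disjoint_part A j i' i hi') (mem_obs.1 hl)), mul_zero]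

/-- The likelihood of the observations in `A` for the conditional density within `A`. -/
def likelihood (T : PartitionScheme R μ) (x : Fin n → Ω) (A : R) (ω : T.Config) : ℝ≥0∞ :=
  ∏ l ∈ T.obs x A, T.density ω A (x l)

/-- The likelihood of the observations in `A` for the density on the parts stopped after `k`
steps. -/
def stoppedLikelihood (T : PartitionScheme R μ) (k : ℕ) (x : Fin n → Ω) (A : R) (ω : T.Config) :
    ℝ≥0∞ :=
  ∏ l ∈ T.obs x A, T.stoppedDensity ω k A (x l)

theorem prod_obs_elim (x : Fin n → Ω) (A : R) (v : T.Node A)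
    {q : R → Ω → ℝ≥0∞} (hq : ∀ B y, y ∉ T.toSet B → q B y = 0) :
    ∏ l ∈ T.obs x A, v.1.elim ((T.toSet A).indicator (fun _ => (μ (T.toSet A))⁻¹) (x l))
      (fun j => ∑ i, ENNReal.ofReal (v.2 j i) * q (T.part A j i) (x l)) =
    v.1.elim (T.uniformLikelihood x A) fun j =>
      (∏ i, ENNReal.ofReal (v.2 j i) ^ (T.obs x (T.part A j i)).card) *
        ∏ i, ∏ l ∈ T.obs x (T.part A j i), q (T.part A j i) (x l) := by
  rcases v with ⟨_ | j, θ⟩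
  · exact Finset.prod_congr rfl fun l hl =>
      Set.indicator_of_mem (mem_obs.1 hl) fun _ => (μ (T.toSet A))⁻¹
  · exact T.prod_obs_sum x A j _ hq

theorem likelihood_eq (x : Fin n → Ω) (A : R) (ω : T.Config) :
    T.likelihood x A ω = (ω A).1.elim (T.uniformLikelihood x A) fun j =>
      (∏ i, ENNReal.ofReal ((ω A).2 j i) ^ (T.obs x (T.part A j i)).card) *
        ∏ i, T.likelihood x (T.part A j i) ω := by
  unfold likelihood
  rw [← T.prod_obs_elim x A (ω A) fun B y h => T.density_of_notMem ω h]
  exact Finset.prod_congr rfl fun l _ => T.density_eq ω A (x l)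

theorem stoppedLikelihood_succ (k : ℕ) (x : Fin n → Ω) (A : R) (ω : T.Config) :
    T.stoppedLikelihood (k + 1) x A ω = (ω A).1.elim (T.uniformLikelihood x A) fun j =>
      (∏ i, ENNReal.ofReal ((ω A).2 j i) ^ (T.obs x (T.part A j i)).card) *
        ∏ i, T.stoppedLikelihood k x (T.part A j i) ω := by
  unfold stoppedLikelihood
  rw [← T.prod_obs_elim x A (ω A) fun B y h => T.stoppedDensity_of_notMem ω k h]
  exact Finset.prod_congr rfl fun l _ => T.stoppedDensity_succ ω k A (x l)

theorem measurable_likelihood_uncurry (A : R) :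
    Measurable fun p : T.Config × (Fin n → Ω) => T.likelihood p.2 A p.1 := by
  classical
  unfold likelihood obs
  simp_rw [Finset.prod_filter]
  refine Finset.measurable_prod _ fun l _ => Measurable.ite ?_ ?_ measurable_const
  · exact (T.measurableSet_toSet A).preimage (by fun_prop)
  · exact (T.measurable_density A).comp (f := fun p : T.Config × (Fin n → Ω) => (p.1, p.2 l))
      (by fun_prop)

theorem measurable_likelihood (x : Fin n → Ω) (A : R) : Measurable (T.likelihood x A) :=
  (T.measurable_likelihood_uncurry A).comp (measurable_id.prodMk measurable_const)

theorem measurable_stoppedLikelihood (k : ℕ) (x : Fin n → Ω) (A : R) :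
    Measurable (T.stoppedLikelihood k x A) :=
  Finset.measurable_prod _ fun _ _ => (T.measurable_stoppedDensity k A).comp
    (measurable_id.prodMk measurable_const)

theorem dependsOn_likelihood (x : Fin n → Ω) (A : R) :
    DependsOn (T.likelihood x A) (T.below A) := fun _ _ h =>
  Finset.prod_congr rfl fun _ _ => T.dependsOn_density A _ h

theorem dependsOn_stoppedLikelihood (k : ℕ) (x : Fin n → Ω) (A : R) :
    DependsOn (T.stoppedLikelihood k x A) (T.below A) := fun _ _ h =>
  Finset.prod_congr rfl fun _ _ => T.dependsOn_stoppedDensity k A _ h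

theorem Params.marginalLikelihood_eq_lintegral (P : T.Params) (x : Fin n → Ω) (A : R) :
    P.marginalLikelihood x A = ∫⁻ ω, T.likelihood x A ω ∂P.law := rfl

theorem Params.marginalLikelihood_of_obs_empty (P : T.Params) (x : Fin n → Ω) (A : R)
    (h : T.obs x A = ∅) : P.marginalLikelihood x A = 1 := by
  simp [Params.marginalLikelihood, h]

theorem Params.marginalLikelihood_eq (P : T.Params) (x : Fin n → Ω) (A : R) :
    P.marginalLikelihood x A = ENNReal.ofReal (P.rho A) * T.uniformLikelihood x A +
      ENNReal.ofReal (1 - P.rho A) * ∑ j, P.selWeight x A j := by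
  rw [P.marginalLikelihood_eq_lintegral]
  simp_rw [T.likelihood_eq x A]
  rw [P.lintegral_law_elim_prod A _ _ (T.measurable_likelihood x) (T.dependsOn_likelihood x)]
  congr! 4 with j
  rw [Params.selWeight, mul_assoc]
  rfl

end Likelihood

end PartitionScheme

/-! ### Variational distance -/

/-- On `B` and on `Bᶜ` both measures dominate `σ`, so each value on `B` lies between `σ(B)` and `1 -
σ(Bᶜ)`, an interval of length `1 - σ(Ω)`. -/
theorem abs_measureReal_sub_le {Ω : Type*} [MeasurableSpace Ω] {ν ν' σ : Measure Ω}
    [IsProbabilityMeasure ν] [IsProbabilityMeasure ν'] (h : σ ≤ ν) (h' : σ ≤ ν') {B : Set Ω}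
    (hB : MeasurableSet B) : |ν.real B - ν'.real B| ≤ 1 - σ.real Set.univ := by
  have : IsFiniteMeasure σ := isFiniteMeasure_of_le ν h
  have e1 := probReal_add_probReal_compl (μ := ν) hB
  have e2 := probReal_add_probReal_compl (μ := ν') hB
  have e3 := measureReal_add_measureReal_compl (μ := σ) hB
  have mono : ∀ (τ : Measure Ω) [IsProbabilityMeasure τ], σ ≤ τ → ∀ C, σ.real C ≤ τ.real C :=
    fun τ _ hτ C => ENNReal.toReal_mono (measure_ne_top τ C) (hτ C)
  have h1 := mono ν h B
  have h2 := mono ν h Bᶜ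
  have h3 := mono ν' h' B
  have h4 := mono ν' h' Bᶜ
  rw [abs_le]
  constructor <;> linarith

theorem TendstoInVariation.unique {Ω : Type*} [MeasurableSpace Ω] {Q' : ℕ → Measure Ω}
    {ν ν' : Measure Ω} [IsFiniteMeasure ν] [IsFiniteMeasure ν'] (h : TendstoInVariation Q' ν)
    (h' : TendstoInVariation Q' ν') : ν = ν' := by
  ext B hB
  have := tendsto_nhds_unique (h.tendsto_at hB) (h'.tendsto_at hB)
  exact (measureReal_eq_measureReal_iff (measure_ne_top _ _) (measure_ne_top _ _)).1 this

/-! ### Mass of the density and convergence of the construction -/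

namespace PartitionScheme

variable {Ω : Type*} [MeasurableSpace Ω] {R : Type*} {μ : Measure Ω} {T : PartitionScheme R μ}

/-- The probabilities attached to the parts of every partition add up to one. -/
def IsRegular (T : PartitionScheme R μ) (ω : T.Config) : Prop :=
  ∀ A j, ∑ i, ENNReal.ofReal ((ω A).2 j i) = 1

theorem Params.ae_isRegular [Countable R] (P : T.Params) : ∀ᵐ ω ∂P.law, T.IsRegular ω := by
  refine ae_all_iff.2 fun A => ae_all_iff.2 fun j => ?_
  have := T.neZero_parts A j
  have h1 : ∀ᵐ v ∂P.nodeLaw A, ∑ i, ENNReal.ofReal (v.2 j i) = 1 :=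
    ((measurePreserving_eval (fun j => dirichlet (P.alpha A j)) j).comp
      (measurePreserving_snd (μ := P.decisionLaw A))).quasiMeasurePreserving.ae
      (ae_dirichlet_sum_eq_one (P.alpha_pos A j))
  exact (measurePreserving_eval_infinitePi P.nodeLaw A).quasiMeasurePreserving.ae h1

variable [IsFiniteMeasure μ]

theorem inv_mul_measure_toSet (A : R) : (μ (T.toSet A))⁻¹ * μ (T.toSet A) = 1 :=
  ENNReal.inv_mul_cancel (T.measure_toSet_pos A).ne' (measure_ne_top _ _)

omit [IsFiniteMeasure μ] in
theorem measurable_stoppedDensity_right (ω : T.Config) (k : ℕ) (A : R) :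
    Measurable (T.stoppedDensity ω k A) :=
  (T.measurable_stoppedDensity k A).comp (measurable_const.prodMk measurable_id)

omit [IsFiniteMeasure μ] in
theorem measurable_density_right (ω : T.Config) (A : R) : Measurable (T.density ω A) :=
  (T.measurable_density A).comp (measurable_const.prodMk measurable_id)

theorem lintegral_stoppedDensity_succ (ω : T.Config) (k : ℕ) (A : R) :
    ∫⁻ y, T.stoppedDensity ω (k + 1) A y ∂μ = (ω A).1.elim 1 fun j =>
      ∑ i, ENNReal.ofReal ((ω A).2 j i) * ∫⁻ y, T.stoppedDensity ω k (T.part A j i) y ∂μ := by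
  simp_rw [stoppedDensity_succ]
  cases (ω A).1 with
  | halt =>
    simp only [Decision.elim_halt]
    rw [lintegral_indicator_const (T.measurableSet_toSet A), inv_mul_measure_toSet]
  | split j =>
    simp only [Decision.elim_split]
    have hm := fun i => T.measurable_stoppedDensity_right ω k (T.part A j i)
    rw [lintegral_finsetSum _ fun i _ => (hm i).const_mul _]
    exact Finset.sum_congr rfl fun i _ => lintegral_const_mul _ (hm i)

theorem lintegral_stoppedDensity_le_one {ω : T.Config} (hω : T.IsRegular ω) (k : ℕ) (A : R) :
    ∫⁻ y, T.stoppedDensity ω k A y ∂μ ≤ 1 := by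
  induction k generalizing A with
  | zero => simp [stoppedDensity]
  | succ k ih =>
    rw [lintegral_stoppedDensity_succ]
    rcases (ω A).1 with _ | j
    · exact le_rfl
    · rw [Decision.elim_split, ← hω A j]
      exact Finset.sum_le_sum fun i _ => mul_le_of_le_one_right' (ih _)

omit [IsFiniteMeasure μ] in
theorem lintegral_density_eq_iSup (ω : T.Config) (A : R) :
    ∫⁻ y, T.density ω A y ∂μ = ⨆ k, ∫⁻ y, T.stoppedDensity ω k A y ∂μ :=
  lintegral_iSup (fun k => T.measurable_stoppedDensity_right ω k A) fun _ _ h y =>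
    T.monotone_stoppedDensity ω A y h

theorem lintegral_density_le_one {ω : T.Config} (hω : T.IsRegular ω) (A : R) :
    ∫⁻ y, T.density ω A y ∂μ ≤ 1 := by
  rw [lintegral_density_eq_iSup]
  exact iSup_le fun k => T.lintegral_stoppedDensity_le_one hω k A

theorem partialMeasure_univ {ω : T.Config} (hω : T.IsRegular ω) (k : ℕ) (A : R) :
    T.partialMeasure ω k A Set.univ = 1 := by
  have hc := fun A => cond_isProbabilityMeasure (T.measure_toSet_pos A).ne'
  induction k generalizing A with
  | zero => exact (hc A).measure_univ
  | succ k ih =>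
    have h := hω A
    rw [partialMeasure]
    split
    · exact (hc A).measure_univ
    · simp [ih, h]

omit [IsFiniteMeasure μ] in
theorem withDensity_stoppedDensity_le (ω : T.Config) (k : ℕ) (A : R) :
    μ.withDensity (T.stoppedDensity ω k A) ≤ T.partialMeasure ω k A := by
  induction k generalizing A with
  | zero =>
    refine Measure.le_iff.2 fun B hB => ?_
    rw [withDensity_apply _ hB]
    simp [stoppedDensity]
  | succ k ih =>
    refine Measure.le_iff.2 fun B hB => ?_
    rw [withDensity_apply _ hB, partialMeasure]
    simp_rw [stoppedDensity_succ]
    rcases (ω A).1 with _ | j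
    · simp only [Decision.elim_halt]
      rw [lintegral_indicator_const (T.measurableSet_toSet A), cond_apply (T.measurableSet_toSet A),
        Measure.restrict_apply (T.measurableSet_toSet A)]
    · simp only [Decision.elim_split]
      have hm := fun i => T.measurable_stoppedDensity_right ω k (T.part A j i)
      rw [lintegral_finsetSum _ fun i _ => (hm i).const_mul _, Measure.coe_finsetSum,
        Finset.sum_apply]
      refine Finset.sum_le_sum fun i _ => ?_
      rw [lintegral_const_mul _ (hm i), Measure.smul_apply, smul_eq_mul,
        ← withDensity_apply _ hB]
      gcongr
      exact ih _

/-- The stopped part is a common minorant of the partial measure and the limit, and its mass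
increases to one. -/
theorem tendstoInVariation_of_lintegral_density_eq_one {ω : T.Config} (hω : T.IsRegular ω) {A : R}
    (h1 : ∫⁻ y, T.density ω A y ∂μ = 1) :
    TendstoInVariation (fun k => T.partialMeasure ω k A) (μ.withDensity (T.density ω A)) := by
  have hp : ∀ k, IsProbabilityMeasure (T.partialMeasure ω k A) := fun k =>
    ⟨T.partialMeasure_univ hω k A⟩
  have hq : IsProbabilityMeasure (μ.withDensity (T.density ω A)) :=
    ⟨by rw [withDensity_apply _ MeasurableSet.univ, setLIntegral_univ, h1]⟩
  have ht : Filter.Tendsto (fun k => (∫⁻ y, T.stoppedDensity ω k A y ∂μ).toReal) Filter.atTop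
      (nhds 1) := by
    rw [← ENNReal.toReal_one, ← h1]
    refine (ENNReal.tendsto_toReal (by rw [h1]; exact ENNReal.one_ne_top)).comp ?_
    rw [lintegral_density_eq_iSup]
    exact tendsto_atTop_iSup fun k k' h => lintegral_mono fun y =>
      T.monotone_stoppedDensity ω A y h
  refine Metric.tendstoUniformlyOn_iff.2 fun ε hε => ?_
  filter_upwards [ht.eventually (lt_mem_nhds (show 1 - ε < 1 by linarith))] with k hk B hB
  have hle : μ.withDensity (T.stoppedDensity ω k A) ≤ μ.withDensity (T.density ω A) :=
    withDensity_mono (Filter.Eventually.of_forall fun y =>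
      le_iSup (fun k => T.stoppedDensity ω k A y) k)
  have := abs_measureReal_sub_le hle (T.withDensity_stoppedDensity_le ω k A) hB
  rw [measureReal_def (μ.withDensity (T.stoppedDensity ω k A)),
    withDensity_apply _ MeasurableSet.univ, setLIntegral_univ] at this
  rw [Real.dist_eq]
  linarith

omit [IsFiniteMeasure μ] in
theorem measurable_lintegral_stoppedDensity [SFinite μ] (k : ℕ) (A : R) :
    Measurable fun ω : T.Config => ∫⁻ y, T.stoppedDensity ω k A y ∂μ :=
  (T.measurable_stoppedDensity k A).lintegral_prod_right'

omit [IsFiniteMeasure μ] in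
theorem measurable_setLIntegral_density [SFinite μ] (A : R) (B : Set Ω) :
    Measurable fun ω : T.Config => ∫⁻ y in B, T.density ω A y ∂μ :=
  (T.measurable_density A).lintegral_prod_right'

/-- With probability `ρ(A)` all mass stops at once; otherwise the deficit is the average of the
parts' deficits with weights `E θ_i` of sum one. So each step contributes a factor `1 - ρ(A) ≤ 1 -
δ`. The additive form avoids truncated subtraction. -/
theorem Params.one_le_lintegral_stoppedDensity_add (P : T.Params) {δ : ℝ}
    (hrho : ∀ A, T.ways A ≠ 0 → δ < P.rho A) (k : ℕ) (A : R) :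
    1 ≤ ∫⁻ ω, ∫⁻ y, T.stoppedDensity ω k A y ∂μ ∂P.law + ENNReal.ofReal (1 - δ) ^ k := by
  induction k generalizing A with
  | zero => simp
  | succ k ih =>
    have hm := fun B => T.measurable_lintegral_stoppedDensity k B
    simp_rw [lintegral_stoppedDensity_succ]
    rw [P.lintegral_law_elim A 1 (G := fun j θ ω => ∑ i, ENNReal.ofReal (θ i) *
      ∫⁻ y, T.stoppedDensity ω k (T.part A j i) y ∂μ)]
    -- If `A` cannot be partitioned then `ρ(A) = 1` and the whole mass stops here.
    · rcases eq_or_ne (T.ways A) 0 with h0 | h0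
      · simp [P.rho_eq_one A h0]
      set ε := ENNReal.ofReal (1 - δ) ^ k with hε
      have hinner : ∀ j, 1 ≤ (∫⁻ θ, ∫⁻ ω, ∑ i, ENNReal.ofReal (θ i) *
          ∫⁻ y, T.stoppedDensity ω k (T.part A j i) y ∂μ ∂P.law ∂dirichlet (P.alpha A j)) + ε := by
        intro j
        have := T.neZero_parts A j
        have hsum : ∑ i, ∫⁻ θ, ENNReal.ofReal (θ i) ∂dirichlet (P.alpha A j) = 1 := by
          rw [← lintegral_finsetSum _ fun i _ => by fun_prop,
            lintegral_congr_ae (ae_dirichlet_sum_eq_one (P.alpha_pos A j))]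
          simp
        have hcalc : ∀ θ : Fin (T.parts A j) → ℝ, ∫⁻ ω, ∑ i, ENNReal.ofReal (θ i) *
            ∫⁻ y, T.stoppedDensity ω k (T.part A j i) y ∂μ ∂P.law = ∑ i, ENNReal.ofReal (θ i) *
            ∫⁻ ω, ∫⁻ y, T.stoppedDensity ω k (T.part A j i) y ∂μ ∂P.law := fun θ => by
          rw [lintegral_finsetSum _ fun i _ => (hm _).const_mul _]
          exact Finset.sum_congr rfl fun i _ => lintegral_const_mul _ (hm _)
        simp_rw [hcalc]
        rw [lintegral_finsetSum _ fun i _ => by fun_prop]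
        have hmul : ∀ i (c : ℝ≥0∞), ∫⁻ θ : Fin (T.parts A j) → ℝ, ENNReal.ofReal (θ i) * c
            ∂dirichlet (P.alpha A j) =
            (∫⁻ θ, ENNReal.ofReal (θ i) ∂dirichlet (P.alpha A j)) * c := fun i c =>
          lintegral_mul_const _ (by fun_prop)
        simp_rw [hmul]
        calc (1 : ℝ≥0∞) = ∑ i, (∫⁻ θ, ENNReal.ofReal (θ i) ∂dirichlet (P.alpha A j)) * 1 := by
              simp_rw [mul_one]; exact hsum.symm
          _ ≤ ∑ i, (∫⁻ θ, ENNReal.ofReal (θ i) ∂dirichlet (P.alpha A j)) *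
              (∫⁻ ω, ∫⁻ y, T.stoppedDensity ω k (T.part A j i) y ∂μ ∂P.law + ε) :=
              Finset.sum_le_sum fun i _ => by gcongr; exact ih _
          _ = _ := by
              simp_rw [mul_add]
              rw [Finset.sum_add_distrib, ← Finset.sum_mul, hsum, one_mul]
      have hlam : ∑ j, ENNReal.ofReal (P.lam A j) = 1 := by
        rw [← ENNReal.ofReal_sum_of_nonneg fun j _ => P.lam_nonneg A j, P.sum_lam A h0,
          ENNReal.ofReal_one]
      have hone : ENNReal.ofReal (P.rho A) + ENNReal.ofReal (1 - P.rho A) = 1 := by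
        rw [← ENNReal.ofReal_add (P.rho_nonneg A) (sub_nonneg.2 (P.rho_le_one A)),
          add_sub_cancel, ENNReal.ofReal_one]
      calc (1 : ℝ≥0∞) = ENNReal.ofReal (P.rho A) * 1 + ENNReal.ofReal (1 - P.rho A) *
            ∑ j, ENNReal.ofReal (P.lam A j) * 1 := by simp_rw [mul_one, hlam, mul_one, hone]
        _ ≤ ENNReal.ofReal (P.rho A) * 1 + ENNReal.ofReal (1 - P.rho A) *
            ∑ j, ENNReal.ofReal (P.lam A j) * ((∫⁻ θ, ∫⁻ ω, ∑ i, ENNReal.ofReal (θ i) *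
            ∫⁻ y, T.stoppedDensity ω k (T.part A j i) y ∂μ ∂P.law ∂dirichlet (P.alpha A j)) +
            ε) := by
            gcongr with j _
            exact hinner j
        _ = ENNReal.ofReal (P.rho A) * 1 + ENNReal.ofReal (1 - P.rho A) *
            ∑ j, ENNReal.ofReal (P.lam A j) * (∫⁻ θ, ∫⁻ ω, ∑ i, ENNReal.ofReal (θ i) *
            ∫⁻ y, T.stoppedDensity ω k (T.part A j i) y ∂μ ∂P.law ∂dirichlet (P.alpha A j)) +
            ENNReal.ofReal (1 - P.rho A) * ε := by
            simp_rw [mul_add]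
            rw [Finset.sum_add_distrib, ← Finset.sum_mul, hlam, one_mul, mul_add, add_assoc]
        _ ≤ _ := by
            rw [pow_succ', ← hε]
            gcongr
            exact (hrho A h0).le
    · intro j
      exact Finset.measurable_sum _ fun i _ =>
        Measurable.mul (by fun_prop) ((hm _).comp measurable_snd)
    · intro j θ ω ω' h
      refine Finset.sum_congr rfl fun i _ => congrArg _ (lintegral_congr fun y => ?_)
      exact T.dependsOn_stoppedDensity k _ y fun B hB => h B (T.below_part_subset_compl A j i hB)

/-- The mass is almost surely at most one, so a mean of at least one forces equality. The prior and
the posterior bound this mean by different arguments. -/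
theorem Params.ae_lintegral_density_eq_one_of_le [Countable R] (P : T.Params) {A : R}
    (h : 1 ≤ ∫⁻ ω, ∫⁻ y, T.density ω A y ∂μ ∂P.law) :
    ∀ᵐ ω ∂P.law, ∫⁻ y, T.density ω A y ∂μ = 1 := by
  have hm := T.measurable_setLIntegral_density A Set.univ
  simp_rw [setLIntegral_univ] at hm
  have hle : ∀ᵐ ω ∂P.law, ∫⁻ y, T.density ω A y ∂μ ≤ 1 := by
    filter_upwards [P.ae_isRegular] with ω hω using T.lintegral_density_le_one hω A
  refine ae_eq_of_ae_le_of_lintegral_le hle ?_ aemeasurable_const (by simpa using h)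
  exact ((lintegral_mono_ae hle).trans_lt (by simp)).ne

theorem Params.ae_lintegral_density_eq_one [Countable R] (P : T.Params) {δ : ℝ} (hδ : 0 < δ)
    (hrho : ∀ A, T.ways A ≠ 0 → δ < P.rho A) (A : R) :
    ∀ᵐ ω ∂P.law, ∫⁻ y, T.density ω A y ∂μ = 1 := by
  refine P.ae_lintegral_density_eq_one_of_le ?_
  have hr : ENNReal.ofReal (1 - δ) < 1 := by
    rw [ENNReal.ofReal_lt_one]; linarith
  have ht : Filter.Tendsto (fun k : ℕ => ∫⁻ ω, ∫⁻ y, T.density ω A y ∂μ ∂P.law +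
      ENNReal.ofReal (1 - δ) ^ k) Filter.atTop
      (nhds (∫⁻ ω, ∫⁻ y, T.density ω A y ∂μ ∂P.law + 0)) :=
    tendsto_const_nhds.add (ENNReal.tendsto_pow_atTop_nhds_zero_of_lt_one hr)
  rw [add_zero] at ht
  refine ge_of_tendsto' ht fun k => (P.one_le_lintegral_stoppedDensity_add hrho k A).trans ?_
  gcongr with ω y
  exact le_iSup (fun k => T.stoppedDensity ω k A y) k

theorem Params.ae_tendstoInVariation_density [Countable R] (P : T.Params) {A : R}
    (h : ∀ᵐ ω ∂P.law, ∫⁻ y, T.density ω A y ∂μ = 1) :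
    ∀ᵐ ω ∂P.law, TendstoInVariation
      (fun k => T.partialMeasure ω k A) (μ.withDensity (T.density ω A)) := by
  filter_upwards [h, P.ae_isRegular] with ω h1 hω
  exact T.tendstoInVariation_of_lintegral_density_eq_one hω h1

end PartitionScheme

/-! ### Products of increasing limits -/

theorem ennreal_iSup_mul_iSup_of_monotone {f g : ℕ → ℝ≥0∞} (hf : Monotone f) (hg : Monotone g) :
    (⨆ k, f k) * ⨆ k, g k = ⨆ k, f k * g k := by
  refine le_antisymm ?_ ENNReal.iSup_mul_le
  simp_rw [ENNReal.iSup_mul, ENNReal.mul_iSup]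
  refine iSup_le fun k => iSup_le fun l => le_iSup_of_le (max k l) ?_
  exact mul_le_mul' (hf (le_max_left k l)) (hg (le_max_right k l))

theorem ennreal_prod_iSup_of_monotone {ι : Type*} (s : Finset ι) {f : ι → ℕ → ℝ≥0∞}
    (hf : ∀ i, Monotone (f i)) : ∏ i ∈ s, ⨆ k, f i k = ⨆ k, ∏ i ∈ s, f i k := by
  classical
  induction s using Finset.induction_on with
  | empty => simp
  | insert i s hi ih =>
    simp_rw [Finset.prod_insert hi]
    rw [ih, ennreal_iSup_mul_iSup_of_monotone (hf i)]
    exact fun k l h => Finset.prod_le_prod' fun i _ => hf i h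

/-! ### Random measures are determined by their moments -/

section Moments

/-- A finite measure on a finite power of the unit interval is determined by its mixed moments. -/
theorem ext_of_integral_prod_unitInterval {κ : Type*} [Finite κ]
    {ν ν' : Measure (κ → unitInterval)} [IsFiniteMeasure ν] [IsFiniteMeasure ν']
    (h : ∀ (m : ℕ) (b : Fin m → κ),
      ∫ z, ∏ l, (z (b l) : ℝ) ∂ν = ∫ z, ∏ l, (z (b l) : ℝ) ∂ν') : ν = ν' := by
  have := Fintype.ofFinite κ
  let c : κ → BoundedContinuousFunction (κ → unitInterval) ℝ := fun b =>
    BoundedContinuousFunction.mkOfCompact ⟨fun z => (z b : ℝ), by fun_prop⟩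
  -- The polynomials in the coordinates separate points, so a Stone–Weierstrass type criterion
  -- applies; conjugation is trivial on real functions.
  let A : StarSubalgebra ℝ (BoundedContinuousFunction (κ → unitInterval) ℝ) :=
    { Algebra.adjoin ℝ (Set.range c) with
      star_mem' := fun {f} hf => by
        have : star f = f := by ext z; simp
        rwa [this] }
  have hcA : ∀ b, c b ∈ A := fun b => Algebra.subset_adjoin ⟨b, rfl⟩
  refine ext_of_forall_mem_subalgebra_integral_eq_of_polish (A := A) ?_ ?_
  · intro z z' hz
    obtain ⟨b, hb⟩ := Function.ne_iff.1 hz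
    refine ⟨_, ⟨_, ⟨c b, hcA b, rfl⟩, rfl⟩, ?_⟩
    exact fun h => hb (Subtype.ext h)
  · intro g hg
    have hg' : g ∈ Subalgebra.toSubmodule (Algebra.adjoin ℝ (Set.range c)) := hg
    -- The generated algebra is the linear span of the monomials, and on those the hypothesis
    -- applies.
    rw [Algebra.adjoin_eq_span] at hg'
    induction hg' using Submodule.span_induction with
    | mem f hf =>
      clear hg
      obtain ⟨m, b, hfb⟩ : ∃ (m : ℕ) (b : Fin m → κ), ∀ z, f z = ∏ l, (z (b l) : ℝ) := by
        induction hf using Submonoid.closure_induction with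
        | mem f hf =>
          obtain ⟨b, rfl⟩ := hf
          exact ⟨1, fun _ => b, fun z => by simp [c]⟩
        | one => exact ⟨0, Fin.elim0, fun z => by simp⟩
        | mul f g _ _ hf hg =>
          obtain ⟨m, b, hf⟩ := hf
          obtain ⟨m', b', hg⟩ := hg
          exact ⟨m + m', Fin.append b b', fun z => by simp [hf, hg, Fin.prod_univ_add]⟩
      simp_rw [hfb]
      exact h m b
    | zero => simp
    | add f g hf hg ihf ihg =>
      have e : ∀ (f g : BoundedContinuousFunction (κ → unitInterval) ℝ)
          (ν : Measure (κ → unitInterval)) [IsFiniteMeasure ν],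
          ∫ z, (f + g) z ∂ν = ∫ z, f z ∂ν + ∫ z, g z ∂ν := fun f g ν _ =>
        integral_add (f.integrable ν) (g.integrable ν)
      rw [e, e, ihf, ihg]
      all_goals exact (Algebra.adjoin_eq_span ℝ (Set.range c)).ge ‹_›
    | smul a f hf ihf =>
      have e : ∀ (ν : Measure (κ → unitInterval)), ∫ z, (a • f) z ∂ν = a * ∫ z, f z ∂ν :=
        fun ν => integral_const_mul a _
      rw [e, e, ihf]
      exact (Algebra.adjoin_eq_span ℝ (Set.range c)).ge ‹_›

variable {Ω : Type*} [MeasurableSpace Ω]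

/-- The probabilities of all measurable sets under a probability measure. -/
def probabilities (Q : ProbabilityMeasure Ω) (B : {B : Set Ω // MeasurableSet B}) : unitInterval :=
  ⟨(Q : Measure Ω).real B, measureReal_nonneg, measureReal_le_one⟩

theorem measurable_probabilities : Measurable (probabilities (Ω := Ω)) :=
  measurable_pi_lambda _ fun B =>
    (((Measure.measurable_coe B.2).comp measurable_subtype_coe).ennreal_toReal).subtype_mk

/-- Evaluations at measurable sets generate the σ-algebra on measures, so equality in law of all the
numbers `Q(B)` returns to equality of the laws of `Q`. -/
theorem comap_probabilities_ge :
    (inferInstance : MeasurableSpace (ProbabilityMeasure Ω)) ≤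
      MeasurableSpace.comap (probabilities (Ω := Ω)) inferInstance := by
  refine Measurable.comap_le ?_
  refine Measure.measurable_of_measurable_coe _ fun B hB => ?_
  have h1 : (fun Q : ProbabilityMeasure Ω => (Q : Measure Ω) B) =
      fun Q => ENNReal.ofReal (probabilities Q ⟨B, hB⟩) := by
    ext Q
    exact (ofReal_measureReal (measure_ne_top _ _)).symm
  have h2 : Measurable fun z : {B : Set Ω // MeasurableSet B} → unitInterval =>
      ENNReal.ofReal (z ⟨B, hB⟩) := by fun_prop
  exact h1 ▸ h2.comp (comap_measurable probabilities)

/-- A finite measure on the space of probability measures is determined by the expectations of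
products of probabilities. -/
theorem ext_of_lintegral_prod {π π' : Measure (ProbabilityMeasure Ω)} [IsFiniteMeasure π]
    [IsFiniteMeasure π']
    (h : ∀ (m : ℕ) (B : Fin m → Set Ω), (∀ l, MeasurableSet (B l)) →
      ∫⁻ Q, ∏ l, (Q : Measure Ω) (B l) ∂π = ∫⁻ Q, ∏ l, (Q : Measure Ω) (B l) ∂π') : π = π' := by
  have hE := measurable_probabilities (Ω := Ω)
  -- Finite-dimensional marginals of `(Q(B))_B` live on cubes, where moments decide; the projective
  -- limit is then unique.
  have hfin : ∀ I : Finset {B : Set Ω // MeasurableSet B},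
      (π.map probabilities).map I.restrict = (π'.map probabilities).map I.restrict := by
    intro I
    refine ext_of_integral_prod_unitInterval fun m b => ?_
    have e : ∀ (τ : Measure (ProbabilityMeasure Ω)) [IsFiniteMeasure τ],
        ∫ z, ∏ l, (z (b l) : ℝ) ∂(τ.map probabilities).map I.restrict =
          (∫⁻ Q, ∏ l, (Q : Measure Ω) (b l) ∂τ).toReal := by
      intro τ _
      have hI : Measurable (I.restrict : ((∀ _, unitInterval) → _)) := Finset.measurable_restrict I
      rw [Measure.map_map hI hE, integral_map (hI.comp hE).aemeasurable
        (by fun_prop : Measurable fun z : I → unitInterval =>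
          ∏ l, (z (b l) : ℝ)).aestronglyMeasurable, ← integral_toReal]
      · simp [ENNReal.toReal_prod, probabilities, measureReal_def]
      · exact (Finset.measurable_prod _ fun l _ => (Measure.measurable_coe (b l).1.2).comp
          measurable_subtype_coe).aemeasurable
      · exact Filter.Eventually.of_forall fun Q =>
          ENNReal.prod_lt_top fun l _ => measure_lt_top _ _
    rw [e, e, h m (fun l => (b l).1.1) fun l => (b l).1.2]
  have hmap : π.map probabilities = π'.map probabilities :=
    IsProjectiveLimit.unique (P := fun I => (π'.map probabilities).map I.restrict) hfin
      fun I => rfl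
  ext s hs
  obtain ⟨t, ht, rfl⟩ := comap_probabilities_ge s hs
  rw [← Measure.map_apply hE ht, ← Measure.map_apply hE ht, hmap]

end Moments

/-! ### Posterior parameters and the likelihood identity -/

namespace PartitionScheme

variable {Ω : Type*} [MeasurableSpace Ω] {R : Type*} {μ : Measure Ω} {T : PartitionScheme R μ}
  {n m : ℕ}

theorem uniformLikelihood_lt_top (x : Fin n → Ω) (A : R) : T.uniformLikelihood x A < ⊤ :=
  ENNReal.prod_lt_top fun _ _ => ENNReal.inv_lt_top.2 (T.measure_toSet_pos A)

theorem uniformLikelihood_pos [IsFiniteMeasure μ] (x : Fin n → Ω) (A : R) :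
    0 < T.uniformLikelihood x A := by
  refine pos_iff_ne_zero.2 (Finset.prod_ne_zero_iff.2 fun _ _ => ?_)
  exact ENNReal.inv_ne_zero.2 (measure_ne_top _ _)

theorem Params.marginalLikelihood_pos [IsFiniteMeasure μ] (P : T.Params) (x : Fin n → Ω) {A : R}
    (h : 0 < P.rho A) : 0 < P.marginalLikelihood x A := by
  rw [P.marginalLikelihood_eq]
  exact (ENNReal.mul_pos (ENNReal.ofReal_pos.2 h).ne' (T.uniformLikelihood_pos x A).ne').trans_le
    le_self_add

theorem Params.counts_add_alpha_pos (P : T.Params) (x : Fin n → Ω) (A : R) (j : Fin (T.ways A))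
    (i : Fin (T.parts A j)) : 0 < T.counts x A j i + P.alpha A j i :=
  add_pos_of_nonneg_of_pos (Nat.cast_nonneg _) (P.alpha_pos A j i)

theorem Params.selWeight_lt_top (P : T.Params) {x : Fin n → Ω} (hx : ∀ A, P.marginalLikelihood x A < ⊤)
    (A : R) (j : Fin (T.ways A)) : P.selWeight x A j < ⊤ :=
  ENNReal.mul_lt_top (ENNReal.mul_lt_top ENNReal.ofReal_lt_top ENNReal.ofReal_lt_top)
    (ENNReal.prod_lt_top fun _ _ => hx _)

theorem Params.selWeight_pos (P : T.Params) {x : Fin n → Ω} (hx : ∀ A, 0 < P.marginalLikelihood x A)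
    {A : R} {j : Fin (T.ways A)} (h : 0 < P.lam A j) : 0 < P.selWeight x A j := by
  have := T.neZero_parts A j
  refine ENNReal.mul_pos (ENNReal.mul_pos (ENNReal.ofReal_pos.2 h).ne'
    (ENNReal.ofReal_pos.2 (div_pos (dirichletD_pos fun i => P.counts_add_alpha_pos x A j i)
      (dirichletD_pos (P.alpha_pos A j)))).ne').ne' ?_
  exact Finset.prod_ne_zero_iff.2 fun i _ => (hx _).ne'

theorem Params.toReal_marginalLikelihood (P : T.Params) {x : Fin n → Ω}
    (hx : ∀ A, P.marginalLikelihood x A < ⊤) (A : R) :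
    (P.marginalLikelihood x A).toReal = P.rho A * (T.uniformLikelihood x A).toReal +
      (1 - P.rho A) * ∑ j, (P.selWeight x A j).toReal := by
  rw [P.marginalLikelihood_eq, ENNReal.toReal_add, ENNReal.toReal_mul, ENNReal.toReal_mul,
    ENNReal.toReal_ofReal (P.rho_nonneg A), ENNReal.toReal_ofReal (sub_nonneg.2 (P.rho_le_one A)),
    ENNReal.toReal_sum fun j _ => (P.selWeight_lt_top hx A j).ne]
  · exact ENNReal.mul_ne_top ENNReal.ofReal_ne_top (T.uniformLikelihood_lt_top x A).ne
  · exact ENNReal.mul_ne_top ENNReal.ofReal_ne_top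
      (ENNReal.sum_ne_top.2 fun j _ => (P.selWeight_lt_top hx A j).ne)

theorem Params.sum_selWeight_pos (P : T.Params) {x : Fin n → Ω}
    (hx : ∀ A, 0 < P.marginalLikelihood x A ∧ P.marginalLikelihood x A < ⊤) {A : R}
    (hA : T.ways A ≠ 0) : 0 < ∑ j, (P.selWeight x A j).toReal := by
  obtain ⟨j, _, hj⟩ : ∃ j ∈ Finset.univ, 0 < P.lam A j := by
    refine Finset.exists_lt_of_sum_lt (f := fun _ => 0) ?_
    rw [P.sum_lam A hA]
    simp
  refine Finset.sum_pos' (fun _ _ => ENNReal.toReal_nonneg) ⟨j, Finset.mem_univ j, ?_⟩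
  exact ENNReal.toReal_pos (P.selWeight_pos (fun A => (hx A).1) hj).ne'
    (P.selWeight_lt_top (fun A => (hx A).2) A j).ne

/-- The parameters of the conditional distribution given the observations. -/
def Params.posterior (P : T.Params) (x : Fin n → Ω)
    (hx : ∀ A, 0 < P.marginalLikelihood x A ∧ P.marginalLikelihood x A < ⊤) : T.Params where
  rho A := P.rho A * (T.uniformLikelihood x A).toReal / (P.marginalLikelihood x A).toReal
  lam A j := (P.selWeight x A j).toReal / ∑ l, (P.selWeight x A l).toReal
  alpha A j i := T.counts x A j i + P.alpha A j i
  rho_nonneg A := by have := P.rho_nonneg A; positivity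
  rho_le_one A := by
    refine div_le_one_of_le₀ ?_ ENNReal.toReal_nonneg
    rw [P.toReal_marginalLikelihood fun A => (hx A).2]
    have := mul_nonneg (sub_nonneg.2 (P.rho_le_one A))
      (Finset.sum_nonneg fun j (_ : j ∈ Finset.univ) =>
        (ENNReal.toReal_nonneg (a := P.selWeight x A j)))
    linarith
  -- Without partitions the recursion reduces to `Φ(A) = Φ₀(A)`.
  rho_eq_one A hA := by
    have h0 := ENNReal.toReal_pos (hx A).1.ne' (hx A).2.ne
    have h1 := P.toReal_marginalLikelihood (fun A => (hx A).2) A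
    rw [P.rho_eq_one A hA] at h1 ⊢
    rw [sub_self, zero_mul, add_zero] at h1
    rw [← h1, div_self h0.ne']
  lam_nonneg A j := by positivity
  sum_lam A hA := by
    rw [← Finset.sum_div, div_self (P.sum_selWeight_pos hx hA).ne']
  alpha_pos := P.counts_add_alpha_pos x

section Posterior

variable (P : T.Params) {x : Fin n → Ω}
  (hx : ∀ A, 0 < P.marginalLikelihood x A ∧ P.marginalLikelihood x A < ⊤)


theorem Params.marginalLikelihood_mul_rho (A : R) :
    P.marginalLikelihood x A * ENNReal.ofReal ((P.posterior x hx).rho A) =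
      ENNReal.ofReal (P.rho A) * T.uniformLikelihood x A := by
  have h0 := ENNReal.toReal_pos (hx A).1.ne' (hx A).2.ne
  rw [← ENNReal.ofReal_toReal (hx A).2.ne, ← ENNReal.ofReal_mul ENNReal.toReal_nonneg,
    ← ENNReal.ofReal_toReal (T.uniformLikelihood_lt_top x A).ne,
    ← ENNReal.ofReal_mul (P.rho_nonneg A)]
  congr 1
  exact mul_div_cancel₀ _ h0.ne'

/-- The recursion gives `Φ(A)(1 - ρ(A|x)) = (1 - ρ(A)) ∑ w_l`, and this sum cancels the denominator
of `λ_j(A|x)`. -/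
theorem Params.marginalLikelihood_mul_lam (A : R) (j : Fin (T.ways A)) :
    P.marginalLikelihood x A * (ENNReal.ofReal (1 - (P.posterior x hx).rho A) *
      ENNReal.ofReal ((P.posterior x hx).lam A j)) =
      ENNReal.ofReal (1 - P.rho A) * P.selWeight x A j := by
  have h0 := ENNReal.toReal_pos (hx A).1.ne' (hx A).2.ne
  have hA : T.ways A ≠ 0 := fun h => (h ▸ j).elim0
  have hS := P.sum_selWeight_pos hx hA
  have hρ := sub_nonneg.2 ((P.posterior x hx).rho_le_one A)
  have hw := (P.selWeight_lt_top (fun A => (hx A).2) A j).ne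
  rw [← ENNReal.ofReal_mul hρ]
  nth_rw 1 [← ENNReal.ofReal_toReal (hx A).2.ne]
  rw [← ENNReal.ofReal_toReal hw]
  rw [← ENNReal.ofReal_mul ENNReal.toReal_nonneg,
    ← ENNReal.ofReal_mul (sub_nonneg.2 (P.rho_le_one A))]
  congr 1
  have h1 := P.toReal_marginalLikelihood (fun A => (hx A).2) A
  have h2 : (P.marginalLikelihood x A).toReal * (1 - (P.posterior x hx).rho A) =
      (1 - P.rho A) * ∑ l, (P.selWeight x A l).toReal := by
    rw [mul_sub, mul_one]
    have : (P.marginalLikelihood x A).toReal * (P.posterior x hx).rho A =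
        P.rho A * (T.uniformLikelihood x A).toReal := mul_div_cancel₀ _ h0.ne'
    linarith
  rw [← mul_assoc, h2, mul_assoc]
  congr 1
  exact mul_div_cancel₀ _ hS.ne'

/-- Truncating only `y` makes induction on `k` possible while the likelihood of `x` stays exact. The
one-step formula applies under both laws, with counts of `x` and `y` adding up under the prior. -/
theorem Params.lintegral_likelihood_mul_stoppedLikelihood (k : ℕ) (y : Fin m → Ω) (A : R) :
    ∫⁻ ω, T.likelihood x A ω * T.stoppedLikelihood k y A ω ∂P.law =
      P.marginalLikelihood x A * ∫⁻ ω, T.stoppedLikelihood k y A ω ∂(P.posterior x hx).law := by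
  induction k generalizing A with
  | zero =>
    -- At depth zero this is the constant `1` or `0`, according to whether `y` has no points in `A`.
    have h0 : ∀ ω, T.stoppedLikelihood 0 y A ω = ∏ l ∈ T.obs y A, 0 := fun ω => rfl
    simp_rw [h0]
    rw [lintegral_mul_const _ (T.measurable_likelihood x A)]
    simp [P.marginalLikelihood_eq_lintegral]
  | succ k ih =>
    have hL : ∀ ω : T.Config, T.likelihood x A ω * T.stoppedLikelihood (k + 1) y A ω =
        (ω A).1.elim (T.uniformLikelihood x A * T.uniformLikelihood y A) fun j =>
          (∏ i, ENNReal.ofReal ((ω A).2 j i) ^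
            ((T.obs y (T.part A j i)).card + (T.obs x (T.part A j i)).card)) *
          ∏ i, (T.likelihood x (T.part A j i) ω * T.stoppedLikelihood k y (T.part A j i) ω) := by
      intro ω
      rw [likelihood_eq, stoppedLikelihood_succ]
      cases (ω A).1 with
      | halt => rfl
      | split j =>
        simp only [Decision.elim_split, Finset.prod_mul_distrib, pow_add]
        ring
    simp_rw [hL]
    rw [P.lintegral_law_elim_prod A _ _
      (V := fun B ω => T.likelihood x B ω * T.stoppedLikelihood k y B ω)
      (fun B => (T.measurable_likelihood x B).mul (T.measurable_stoppedLikelihood k y B))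
      (fun B ω ω' h => congrArg₂ (· * ·) (T.dependsOn_likelihood x B h)
        (T.dependsOn_stoppedLikelihood k y B h))]
    simp_rw [stoppedLikelihood_succ]
    rw [(P.posterior x hx).lintegral_law_elim_prod A _ _ (T.measurable_stoppedLikelihood k y)
      (T.dependsOn_stoppedLikelihood k y)]
    simp_rw [ih]
    rw [mul_add, ← mul_assoc, ← mul_assoc, P.marginalLikelihood_mul_rho hx, Finset.mul_sum,
      Finset.mul_sum, Finset.mul_sum]
    congr 1
    refine Finset.sum_congr rfl fun j _ => ?_
    have hlam := P.marginalLikelihood_mul_lam hx A j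
    rw [Params.selWeight] at hlam
    rw [← mul_assoc (ENNReal.ofReal (1 - (P.posterior x hx).rho A)),
      ← mul_assoc (P.marginalLikelihood x A), hlam, Finset.prod_mul_distrib]
    have := T.neZero_parts A j
    have hD : 0 < dirichletD (P.alpha A j) := dirichletD_pos (P.alpha_pos A j)
    have hD' : 0 < dirichletD (T.counts x A j + P.alpha A j) :=
      dirichletD_pos (P.counts_add_alpha_pos x A j)
    -- Dirichlet conjugacy: the moment for the joint counts is the one for `x` under `α` times the
    -- one for `y` under `n_x + α`.
    have hD'' : ENNReal.ofReal (dirichletD ((fun i => (((T.obs y (T.part A j i)).card +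
          (T.obs x (T.part A j i)).card : ℕ) : ℝ)) + P.alpha A j) / dirichletD (P.alpha A j)) =
        ENNReal.ofReal (dirichletD (T.counts x A j + P.alpha A j) / dirichletD (P.alpha A j)) *
        ENNReal.ofReal (dirichletD ((fun i => ((T.obs y (T.part A j i)).card : ℝ)) +
          (P.posterior x hx).alpha A j) / dirichletD ((P.posterior x hx).alpha A j)) := by
      rw [← ENNReal.ofReal_mul (div_pos hD' hD).le]
      congr 1
      have e1 : (P.posterior x hx).alpha A j = T.counts x A j + P.alpha A j := rfl
      have e2 : (fun i => (((T.obs y (T.part A j i)).card +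
          (T.obs x (T.part A j i)).card : ℕ) : ℝ)) + P.alpha A j =
          (fun i => ((T.obs y (T.part A j i)).card : ℝ)) +
            (T.counts x A j + P.alpha A j) := by
        ext i
        simp [counts, add_assoc]
      rw [e1, e2, mul_comm, div_mul_div_cancel₀ hD'.ne']
    rw [hD'']
    ring

theorem Params.lintegral_likelihood_mul_likelihood (y : Fin m → Ω) (A : R) :
    ∫⁻ ω, T.likelihood x A ω * T.likelihood y A ω ∂P.law =
      P.marginalLikelihood x A * ∫⁻ ω, T.likelihood y A ω ∂(P.posterior x hx).law := by
  have hmono : ∀ ω : T.Config, Monotone fun k => T.stoppedLikelihood k y A ω := fun ω k k' h =>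
    Finset.prod_le_prod' fun l _ => T.monotone_stoppedDensity ω A (y l) h
  have hsup : ∀ ω : T.Config, T.likelihood y A ω = ⨆ k, T.stoppedLikelihood k y A ω := fun ω =>
    ennreal_prod_iSup_of_monotone _ fun l => T.monotone_stoppedDensity ω A (y l)
  simp_rw [hsup, ENNReal.mul_iSup]
  rw [lintegral_iSup, lintegral_iSup, ENNReal.mul_iSup]
  · exact iSup_congr fun k => P.lintegral_likelihood_mul_stoppedLikelihood hx k y A
  · exact fun k => T.measurable_stoppedLikelihood k y A
  · exact fun k k' h ω => hmono ω h
  · exact fun k => (T.measurable_likelihood x A).mul (T.measurable_stoppedLikelihood k y A)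
  · intro k k' h ω
    have := hmono ω h
    dsimp only at this ⊢
    gcongr

end Posterior

end PartitionScheme

/-! ### The random measure, the joint law and the posterior kernel -/

namespace PartitionScheme

variable {Ω : Type*} [MeasurableSpace Ω] {R : Type*} {μ : Measure Ω} {T : PartitionScheme R μ}
  {n m : ℕ} [IsFiniteMeasure μ]

omit [IsFiniteMeasure μ] in
theorem Params.measurable_marginalLikelihood (P : T.Params) (A : R) :
    Measurable fun x : Fin n → Ω => P.marginalLikelihood x A :=
  (T.measurable_likelihood_uncurry A).lintegral_prod_left'

open Classical in
/-- The random probability measure with the given density, wherever the density has mass one. -/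
def randomMeasure (T : PartitionScheme R μ) (ω : T.Config) : ProbabilityMeasure Ω :=
  ⟨if ∫⁻ y, T.density ω T.root y ∂μ = 1 then μ.withDensity (T.density ω T.root)
    else cond μ (T.toSet T.root), by
    split_ifs with h
    · exact ⟨by rw [withDensity_apply _ MeasurableSet.univ, setLIntegral_univ, h]⟩
    · exact cond_isProbabilityMeasure (T.measure_toSet_pos _).ne'⟩

theorem coe_randomMeasure {ω : T.Config} (h : ∫⁻ y, T.density ω T.root y ∂μ = 1) :
    (T.randomMeasure ω : Measure Ω) = μ.withDensity (T.density ω T.root) :=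
  if_pos h

theorem measurable_randomMeasure : Measurable T.randomMeasure := by
  classical
  have h1 : (fun ω : T.Config => (T.randomMeasure ω : Measure Ω)) = fun ω =>
      if ∫⁻ y, T.density ω T.root y ∂μ = 1 then μ.withDensity (T.density ω T.root)
      else cond μ (T.toSet T.root) := by
    ext1 ω
    exact if_congr Iff.rfl rfl rfl
  have hm := T.measurable_setLIntegral_density T.root
  have h2 : Measurable fun ω : T.Config => (T.randomMeasure ω : Measure Ω) := by
    rw [h1]
    refine Measurable.ite ?_ ?_ measurable_const
    · have := hm Set.univ
      simp_rw [setLIntegral_univ] at this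
      exact this (measurableSet_singleton 1)
    · refine Measure.measurable_of_measurable_coe _ fun B hB => ?_
      simp_rw [withDensity_apply _ hB]
      exact hm B
  exact h2.subtype_mk

theorem randomMeasure_apply {ω : T.Config} (h : ∫⁻ y, T.density ω T.root y ∂μ = 1) {B : Set Ω}
    (hB : MeasurableSet B) :
    (T.randomMeasure ω : Measure Ω) B = ∫⁻ y in B, T.density ω T.root y ∂μ := by
  rw [coe_randomMeasure h, withDensity_apply _ hB]

omit [IsFiniteMeasure μ] in
theorem likelihood_root (x : Fin n → Ω) (ω : T.Config) :
    T.likelihood x T.root ω = ∏ l, T.density ω T.root (x l) := by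
  rw [likelihood, obs_root]

theorem iidKernel_randomMeasure {ω : T.Config} (h : ∫⁻ y, T.density ω T.root y ∂μ = 1) :
    iidKernel n (T.randomMeasure ω) =
      (Measure.pi fun _ => μ).withDensity fun x => T.likelihood x T.root ω := by
  have hfin : IsFiniteMeasure (μ.withDensity (T.density ω T.root)) :=
    isFiniteMeasure_withDensity (by rw [h]; exact ENNReal.one_ne_top)
  simp_rw [likelihood_root]
  rw [← pi_withDensity (fun _ => μ) (f := fun _ => T.density ω T.root)
    fun _ => T.measurable_density_right ω T.root, ← coe_randomMeasure h]
  rfl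

/-- Limits in variation are unique, so whichever limit the definition supplies agrees almost surely
with the one built from the density. -/
theorem IsOptionalPolyaTree.eq_map_randomMeasure {P : T.Params}
    {π : Measure (ProbabilityMeasure Ω)} (hπ : T.IsOptionalPolyaTree P π)
    (h1 : ∀ᵐ ω ∂P.law, ∫⁻ y, T.density ω T.root y ∂μ = 1)
    (h2 : ∀ᵐ ω ∂P.law, TendstoInVariation
      (fun k => T.partialMeasure ω k T.root) (μ.withDensity (T.density ω T.root))) :
    π = P.law.map T.randomMeasure := by
  obtain ⟨Q, -, hconv, rfl⟩ := hπ
  refine Measure.map_congr ?_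
  filter_upwards [hconv, h1, h2] with ω hω hω1 hω2
  have h : (Q ω : Measure Ω) = T.randomMeasure ω := by
    rw [← coe_randomMeasure hω1] at hω2
    exact hω.unique hω2
  exact Subtype.ext h

theorem Params.isOptionalPolyaTree_map_randomMeasure [Countable R] (P : T.Params)
    (h1 : ∀ᵐ ω ∂P.law, ∫⁻ y, T.density ω T.root y ∂μ = 1) :
    T.IsOptionalPolyaTree P (P.law.map T.randomMeasure) := by
  refine ⟨T.randomMeasure, T.measurable_randomMeasure, ?_, rfl⟩
  filter_upwards [h1, P.ae_tendstoInVariation_density h1] with ω hω hω2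
  rwa [coe_randomMeasure hω]

/-- For almost every `ω` the sample has density `∏ q(x_l)` with respect to `μ^n`; Tonelli then puts
the integral over `x` outside, as conditioning requires. -/
theorem Params.compProd_iidKernel_apply (P : T.Params)
    (h1 : ∀ᵐ ω ∂P.law, ∫⁻ y, T.density ω T.root y ∂μ = 1)
    {E : Set ((Fin n → Ω) × ProbabilityMeasure Ω)} (hE : MeasurableSet E) :
    (P.law.map T.randomMeasure ⊗ₘ iidKernel n).map Prod.swap E =
      ∫⁻ x, ∫⁻ ω, T.likelihood x T.root ω * E.indicator 1 (x, T.randomMeasure ω) ∂P.law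
        ∂Measure.pi fun _ => μ := by
  have hQ := T.measurable_randomMeasure
  have : IsMarkovKernel (iidKernel (Ω := Ω) n) := ⟨fun Q => by
    change IsProbabilityMeasure (Measure.pi fun _ => (Q : Measure Ω)); infer_instance⟩
  have hE' : MeasurableSet (Prod.swap ⁻¹' E : Set (ProbabilityMeasure Ω × (Fin n → Ω))) :=
    measurable_swap hE
  have hL := T.measurable_likelihood_uncurry (n := n) T.root
  have hI : Measurable fun p : T.Config × (Fin n → Ω) =>
      E.indicator (1 : (Fin n → Ω) × ProbabilityMeasure Ω → ℝ≥0∞) (p.2, T.randomMeasure p.1) :=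
    (measurable_one.indicator hE).comp (measurable_snd.prodMk (hQ.comp measurable_fst))
  rw [Measure.map_apply measurable_swap hE, Measure.compProd_apply hE',
    lintegral_map (Kernel.measurable_kernel_prodMk_left hE') hQ,
    lintegral_lintegral_swap (f := fun x ω => T.likelihood x T.root ω *
      E.indicator 1 (x, T.randomMeasure ω)) ((hL.mul hI).comp measurable_swap).aemeasurable]
  refine lintegral_congr_ae ?_
  filter_upwards [h1] with ω hω
  have hEω : MeasurableSet (Prod.mk (T.randomMeasure ω) ⁻¹' (Prod.swap ⁻¹' E)) :=
    measurable_prodMk_left hE'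
  rw [iidKernel_randomMeasure hω, withDensity_apply _ hEω, ← lintegral_indicator hEω]
  refine lintegral_congr fun x => ?_
  by_cases hx : (x, T.randomMeasure ω) ∈ E
  · rw [Set.indicator_of_mem (by exact hx), Set.indicator_of_mem hx, Pi.one_apply, mul_one]
  · rw [Set.indicator_of_notMem (by exact hx), Set.indicator_of_notMem hx, mul_zero]

theorem Params.comp_iidKernel_eq (P : T.Params)
    (h1 : ∀ᵐ ω ∂P.law, ∫⁻ y, T.density ω T.root y ∂μ = 1) :
    iidKernel n ∘ₘ (P.law.map T.randomMeasure) =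
      (Measure.pi fun _ : Fin n => μ).withDensity fun x => P.marginalLikelihood x T.root := by
  have : IsMarkovKernel (iidKernel (Ω := Ω) n) := ⟨fun Q => by
    change IsProbabilityMeasure (Measure.pi fun _ => (Q : Measure Ω)); infer_instance⟩
  ext B hB
  have h2 := P.compProd_iidKernel_apply (n := n) h1 (measurable_fst hB)
  rw [← Measure.snd_compProd, Measure.snd_apply hB, withDensity_apply _ hB,
    ← lintegral_indicator hB]
  rw [Measure.map_apply measurable_swap (measurable_fst hB)] at h2
  refine h2.trans (lintegral_congr fun x => ?_)
  by_cases hx : x ∈ B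
  · simp [hx, P.marginalLikelihood_eq_lintegral]
  · simp [hx]

/-- Which observations enter depends on `x`. Bounding each factor by `1 + q(x_l | A)` allows the
product to run over all indices, and each factor then integrates to at most `μ(Ω) + 1`. -/
theorem Params.lintegral_marginalLikelihood_lt_top [Countable R] (P : T.Params) (A : R) :
    ∫⁻ x : Fin n → Ω, P.marginalLikelihood x A ∂Measure.pi (fun _ => μ) < ⊤ := by
  simp_rw [P.marginalLikelihood_eq_lintegral]
  rw [lintegral_lintegral_swap (f := fun (x : Fin n → Ω) ω => T.likelihood x A ω)
    ((T.measurable_likelihood_uncurry A).comp measurable_swap).aemeasurable]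
  have hle : ∀ᵐ ω ∂P.law, ∫⁻ x : Fin n → Ω, T.likelihood x A ω ∂Measure.pi (fun _ => μ) ≤
      (μ Set.univ + 1) ^ n := by
    filter_upwards [P.ae_isRegular] with ω hω
    calc ∫⁻ x : Fin n → Ω, T.likelihood x A ω ∂Measure.pi (fun _ => μ)
        ≤ ∫⁻ x : Fin n → Ω, ∏ l, (1 + T.density ω A (x l)) ∂Measure.pi (fun _ => μ) := by
          refine lintegral_mono fun x => ?_
          calc T.likelihood x A ω ≤ ∏ l ∈ T.obs x A, (1 + T.density ω A (x l)) :=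
                Finset.prod_le_prod' fun l _ => le_add_self
            _ ≤ _ := Finset.prod_le_prod_of_subset_of_one_le' (Finset.subset_univ _)
                fun l _ _ => le_self_add
      _ = ∏ l : Fin n, ∫⁻ y, (1 + T.density ω A y) ∂μ :=
          lintegral_pi_prod (fun _ => μ) (f := fun _ y => 1 + T.density ω A y)
            fun _ => measurable_const.add (T.measurable_density_right ω A)
      _ ≤ _ := by
          rw [lintegral_add_left measurable_const, lintegral_one, Finset.prod_const,
            Finset.card_univ, Fintype.card_fin]
          gcongr
          exact T.lintegral_density_le_one hω A
  refine (lintegral_mono_ae hle).trans_lt ?_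
  rw [lintegral_const, measure_univ (μ := P.law), mul_one]
  exact ENNReal.pow_lt_top (ENNReal.add_lt_top.2 ⟨measure_lt_top _ _, ENNReal.one_lt_top⟩)

theorem Params.ae_marginalLikelihood_lt_top [Countable R] (P : T.Params) :
    ∀ᵐ x ∂Measure.pi fun _ : Fin n => μ, ∀ A, P.marginalLikelihood x A < ⊤ :=
  ae_all_iff.2 fun A => ae_lt_top (P.measurable_marginalLikelihood A)
    (P.lintegral_marginalLikelihood_lt_top A).ne

section Posterior

variable (P : T.Params) {x : Fin n → Ω}
  (hx : ∀ A, 0 < P.marginalLikelihood x A ∧ P.marginalLikelihood x A < ⊤)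

/-- The product of masses of the `B l` is the integral of `L_y` over `y` in their product, so this
is the likelihood identity integrated in `y`. -/
theorem Params.lintegral_likelihood_mul_prod (B : Fin m → Set Ω) :
    ∫⁻ ω, T.likelihood x T.root ω * ∏ l, ∫⁻ y in B l, T.density ω T.root y ∂μ ∂P.law =
      P.marginalLikelihood x T.root *
        ∫⁻ ω, ∏ l, ∫⁻ y in B l, T.density ω T.root y ∂μ ∂(P.posterior x hx).law := by
  have h1 : ∀ ω : T.Config, ∏ l, ∫⁻ y in B l, T.density ω T.root y ∂μ =
      ∫⁻ y in Set.univ.pi B, T.likelihood y T.root ω ∂Measure.pi (fun _ => μ) := fun ω => by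
    simp_rw [likelihood_root]
    exact (setLIntegral_pi_prod (fun _ => μ) (f := fun _ => T.density ω T.root)
      (fun _ => T.measurable_density_right ω T.root) B).symm
  have hL := T.measurable_likelihood_uncurry (n := m) T.root
  have hLx := T.measurable_likelihood x T.root
  have hLω : ∀ ω, Measurable fun y : Fin m → Ω => T.likelihood y T.root ω := fun ω =>
    hL.comp measurable_prodMk_left
  simp_rw [h1, ← lintegral_const_mul _ (hLω _)]
  rw [lintegral_lintegral_swap (f := fun ω y => T.likelihood y T.root ω) hL.aemeasurable,
    lintegral_lintegral_swap (f := fun ω y => T.likelihood x T.root ω * T.likelihood y T.root ω)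
      ((hLx.comp measurable_fst).mul hL).aemeasurable,
    ← lintegral_const_mul _ hL.lintegral_prod_left']
  exact lintegral_congr fun y => P.lintegral_likelihood_mul_likelihood hx y T.root

/-- With `m = 1` and the whole space as test set, the prior side equals `Φ(Ω)`; cancelling it shows
that the posterior mean mass is one. -/
theorem Params.ae_posterior_lintegral_density_eq_one [Countable R]
    (h1 : ∀ᵐ ω ∂P.law, ∫⁻ y, T.density ω T.root y ∂μ = 1) :
    ∀ᵐ ω ∂(P.posterior x hx).law, ∫⁻ y, T.density ω T.root y ∂μ = 1 := by
  refine (P.posterior x hx).ae_lintegral_density_eq_one_of_le ?_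
  have h := P.lintegral_likelihood_mul_prod hx (m := 1) fun _ => Set.univ
  simp only [Finset.univ_unique, Finset.prod_singleton, setLIntegral_univ] at h
  have h2 : ∫⁻ ω, T.likelihood x T.root ω * ∫⁻ y, T.density ω T.root y ∂μ ∂P.law =
      P.marginalLikelihood x T.root * 1 := by
    rw [P.marginalLikelihood_eq_lintegral, mul_one]
    refine lintegral_congr_ae ?_
    filter_upwards [h1] with ω hω
    rw [hω, mul_one]
  rw [h2] at h
  exact ((ENNReal.mul_right_inj (hx T.root).1.ne' (hx T.root).2.ne).1 h).le

/-- Both finite measures have the same expectations of `∏ Q(B_l)`, by the integrated likelihood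
identity. -/
theorem Params.map_withDensity_likelihood [Countable R]
    (h1 : ∀ᵐ ω ∂P.law, ∫⁻ y, T.density ω T.root y ∂μ = 1) :
    (P.law.withDensity fun ω => (P.marginalLikelihood x T.root)⁻¹ *
        T.likelihood x T.root ω).map T.randomMeasure =
      (P.posterior x hx).law.map T.randomMeasure := by
  have hQ := T.measurable_randomMeasure
  have hLx := T.measurable_likelihood x T.root
  have h0 := (hx T.root).1.ne'
  have hT := (hx T.root).2.ne
  have hfin : IsFiniteMeasure (P.law.withDensity fun ω => (P.marginalLikelihood x T.root)⁻¹ *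
      T.likelihood x T.root ω) := by
    refine isFiniteMeasure_withDensity ?_
    rw [lintegral_const_mul _ hLx, ← P.marginalLikelihood_eq_lintegral,
      ENNReal.inv_mul_cancel h0 hT]
    exact ENNReal.one_ne_top
  have h1' := P.ae_posterior_lintegral_density_eq_one hx h1
  refine ext_of_lintegral_prod fun m B hB => ?_
  have hprod : Measurable fun Q : ProbabilityMeasure Ω => ∏ l, (Q : Measure Ω) (B l) :=
    Finset.measurable_prod _ fun l _ => (Measure.measurable_coe (hB l)).comp measurable_subtype_coe
  have hdens : Measurable fun ω : T.Config => ∏ l, ∫⁻ y in B l, T.density ω T.root y ∂μ :=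
    Finset.measurable_prod _ fun l _ => T.measurable_setLIntegral_density T.root (B l)
  have hae : ∀ P' : T.Params, (∀ᵐ ω ∂P'.law, ∫⁻ y, T.density ω T.root y ∂μ = 1) →
      ∀ᵐ ω ∂P'.law, ∏ l, (T.randomMeasure ω : Measure Ω) (B l) =
        ∏ l, ∫⁻ y in B l, T.density ω T.root y ∂μ := fun P' h => by
    filter_upwards [h] with ω hω
    exact Finset.prod_congr rfl fun l _ => randomMeasure_apply hω (hB l)
  rw [lintegral_map hprod hQ, lintegral_map hprod hQ, lintegral_congr_ae (hae _ h1'),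
    lintegral_withDensity_eq_lintegral_mul _ (hLx.const_mul _)
      (g := fun ω => ∏ l, (T.randomMeasure ω : Measure Ω) (B l)) (hprod.comp hQ)]
  calc _ = ∫⁻ ω, (P.marginalLikelihood x T.root)⁻¹ * (T.likelihood x T.root ω *
        ∏ l, ∫⁻ y in B l, T.density ω T.root y ∂μ) ∂P.law := by
        refine lintegral_congr_ae ?_
        filter_upwards [hae P h1] with ω hω
        simp only [Pi.mul_apply, hω, mul_assoc]
    _ = _ := by
        rw [lintegral_const_mul _ (f := fun ω => T.likelihood x T.root ω *
          ∏ l, ∫⁻ y in B l, T.density ω T.root y ∂μ) (hLx.mul hdens), P.lintegral_likelihood_mul_prod hx,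
          ← mul_assoc, ENNReal.inv_mul_cancel h0 hT, one_mul]

end Posterior

/-- The observations whose marginal likelihood is positive and finite. -/
def Params.regularObservations (P : T.Params) (n : ℕ) : Set (Fin n → Ω) :=
  {x | 0 < P.marginalLikelihood x T.root ∧ P.marginalLikelihood x T.root < ⊤}

omit [IsFiniteMeasure μ] in
theorem Params.measurableSet_regularObservations (P : T.Params) (n : ℕ) :
    MeasurableSet (P.regularObservations n) := by
  have h := P.measurable_marginalLikelihood (n := n) T.root
  exact (measurableSet_lt measurable_const h).inter (measurableSet_lt h measurable_const)

open Classical in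
/-- The conditional distribution of the random measure given the observations: the prior law
reweighted by the likelihood. -/
def Params.posteriorKernel (P : T.Params) (n : ℕ) :
    Kernel (Fin n → Ω) (ProbabilityMeasure Ω) :=
  Kernel.piecewise (P.measurableSet_regularObservations n)
    ((Kernel.withDensity (Kernel.const _ P.law) fun x ω => (P.marginalLikelihood x T.root)⁻¹ *
      T.likelihood x T.root ω).map T.randomMeasure)
    (Kernel.const _ (P.law.map T.randomMeasure))

theorem Params.posteriorKernel_apply_of_mem (P : T.Params) {x : Fin n → Ω}
    (hx : x ∈ P.regularObservations n) : P.posteriorKernel n x =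
      (P.law.withDensity fun ω => (P.marginalLikelihood x T.root)⁻¹ *
        T.likelihood x T.root ω).map T.randomMeasure := by
  classical
  have hm : Measurable (Function.uncurry fun (x : Fin n → Ω) (ω : T.Config) =>
      (P.marginalLikelihood x T.root)⁻¹ * T.likelihood x T.root ω) :=
    ((P.measurable_marginalLikelihood T.root).inv.comp measurable_fst).mul
      ((T.measurable_likelihood_uncurry T.root).comp measurable_swap)
  rw [Params.posteriorKernel, Kernel.piecewise_apply, if_pos hx,
    Kernel.map_apply _ T.measurable_randomMeasure, Kernel.withDensity_apply _ hm,
    Kernel.const_apply]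

instance (P : T.Params) (n : ℕ) : IsMarkovKernel (P.posteriorKernel n) := by
  classical
  refine ⟨fun x => ?_⟩
  by_cases hx : x ∈ P.regularObservations n
  · rw [P.posteriorKernel_apply_of_mem hx]
    refine ⟨?_⟩
    rw [Measure.map_apply T.measurable_randomMeasure MeasurableSet.univ, Set.preimage_univ,
      withDensity_apply _ MeasurableSet.univ, setLIntegral_univ,
      lintegral_const_mul _ (T.measurable_likelihood x T.root), ← P.marginalLikelihood_eq_lintegral,
      ENNReal.inv_mul_cancel hx.1.ne' hx.2.ne]
  · rw [Params.posteriorKernel, Kernel.piecewise_apply, if_neg hx, Kernel.const_apply]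
    exact Measure.isProbabilityMeasure_map T.measurable_randomMeasure.aemeasurable

/-- The marginal density `Φ(Ω)` cancels the normalisation of the kernel, leaving the joint density.
This needs `0 < Φ(Ω) < ∞` for almost every `x` only. -/
theorem Params.isPosterior_posteriorKernel [Countable R] (P : T.Params)
    (h1 : ∀ᵐ ω ∂P.law, ∫⁻ y, T.density ω T.root y ∂μ = 1) (hpos : 0 < P.rho T.root) :
    IsPosterior (P.law.map T.randomMeasure) (P.posteriorKernel n) := by
  have hQ := T.measurable_randomMeasure
  have hΦ := P.measurable_marginalLikelihood (n := n) T.root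
  ext E hE
  have hκ := Kernel.measurable_kernel_prodMk_left (κ := P.posteriorKernel n) hE
  have hsf : SFinite ((Measure.pi fun _ : Fin n => μ).withDensity
      fun x => P.marginalLikelihood x T.root) := inferInstance
  rw [P.compProd_iidKernel_apply h1 hE, P.comp_iidKernel_eq h1, Measure.compProd_apply hE,
    lintegral_withDensity_eq_lintegral_mul _ hΦ hκ]
  refine lintegral_congr_ae ?_
  filter_upwards [P.ae_marginalLikelihood_lt_top (n := n)] with x hx
  have hxS : x ∈ P.regularObservations n := ⟨P.marginalLikelihood_pos x hpos, hx _⟩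
  have hLx := T.measurable_likelihood x T.root
  have hEx : MeasurableSet (T.randomMeasure ⁻¹' (Prod.mk x ⁻¹' E)) :=
    hQ (measurable_prodMk_left hE)
  rw [Pi.mul_apply, P.posteriorKernel_apply_of_mem hxS,
    Measure.map_apply hQ (measurable_prodMk_left hE), withDensity_apply _ hEx,
    lintegral_const_mul _ hLx, ← mul_assoc, ENNReal.mul_inv_cancel hxS.1.ne' hxS.2.ne, one_mul,
    ← lintegral_indicator hEx]
  refine lintegral_congr fun ω => ?_
  by_cases h : (x, T.randomMeasure ω) ∈ E
  · rw [Set.indicator_of_mem (by exact h), Set.indicator_of_mem h, Pi.one_apply, mul_one]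
  · rw [Set.indicator_of_notMem (by exact h), Set.indicator_of_notMem h, mul_zero]

theorem Params.isOptionalPolyaTree_posteriorKernel [Countable R] (P : T.Params)
    (h1 : ∀ᵐ ω ∂P.law, ∫⁻ y, T.density ω T.root y ∂μ = 1) {x : Fin n → Ω}
    (hx : ∀ A, 0 < P.marginalLikelihood x A ∧ P.marginalLikelihood x A < ⊤) :
    T.IsOptionalPolyaTree (P.posterior x hx) (P.posteriorKernel n x) := by
  rw [P.posteriorKernel_apply_of_mem (hx T.root), P.map_withDensity_likelihood hx h1]
  exact (P.posterior x hx).isOptionalPolyaTree_map_randomMeasure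
    (P.ae_posterior_lintegral_density_eq_one hx h1)

end PartitionScheme

end OptionalPolya

end

/-! ### The theorem -/

theorem theorem3 {Ω : Type*} [MeasurableSpace Ω] (μ : Measure Ω) [IsFiniteMeasure μ]
    {R : Type*} [Countable R] (T : OptionalPolya.PartitionScheme R μ) (P : T.Params)
    (δ : ℝ) (hδ : 0 < δ)
    (hrho : ∀ A, T.ways A ≠ 0 → δ < P.rho A ∧ P.rho A < 1 - δ)
    (π : Measure (ProbabilityMeasure Ω)) (hπ : T.IsOptionalPolyaTree P π) (n : ℕ) :
    -- `density` is, almost surely, the density of the random measure induced within each region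
    (∀ A, ∀ᵐ ω ∂P.law, OptionalPolya.TendstoInVariation
      (fun k => T.partialMeasure ω k A) (μ.withDensity (T.density ω A))) ∧
    -- `Φ(Ω)` is the marginal density of the observations
    OptionalPolya.iidKernel n ∘ₘ π =
      (Measure.pi fun _ : Fin n => μ).withDensity (fun x => P.marginalLikelihood x T.root) ∧
    -- the recursion for `Φ`
    (∀ (x : Fin n → Ω) (A : R), T.obs x A = ∅ → P.marginalLikelihood x A = 1) ∧
    (∀ (x : Fin n → Ω) (A : R), P.marginalLikelihood x A =
      ENNReal.ofReal (P.rho A) * T.uniformLikelihood x A +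
        ENNReal.ofReal (1 - P.rho A) * ∑ j, P.selWeight x A j) ∧
    -- the posterior is an optional Pólya tree
    ∃ κ : Kernel (Fin n → Ω) (ProbabilityMeasure Ω), IsMarkovKernel κ ∧
      OptionalPolya.IsPosterior π κ ∧
      ∀ᵐ x ∂(OptionalPolya.iidKernel n ∘ₘ π),
        (∀ A, 0 < P.marginalLikelihood x A ∧ P.marginalLikelihood x A < ⊤) ∧
        ∃ P' : T.Params,
          (∀ A, P'.rho A =
            P.rho A * (T.uniformLikelihood x A).toReal / (P.marginalLikelihood x A).toReal) ∧
          (∀ A j, P'.lam A j =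
            (P.selWeight x A j).toReal / ∑ l, (P.selWeight x A l).toReal) ∧
          (∀ A j i, P'.alpha A j i = T.counts x A j i + P.alpha A j i) ∧
          T.IsOptionalPolyaTree P' (κ x) := by
  have hpos : ∀ A, 0 < P.rho A := fun A => by
    by_cases hA : T.ways A = 0
    · rw [P.rho_eq_one A hA]; exact one_pos
    · exact hδ.trans (hrho A hA).1
  have h1 := P.ae_lintegral_density_eq_one hδ fun A hA => (hrho A hA).1
  have h2 := fun A => P.ae_tendstoInVariation_density (h1 A)
  have hmap := hπ.eq_map_randomMeasure (h1 T.root) (h2 T.root)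
  have hmarg : OptionalPolya.iidKernel n ∘ₘ π =
      (Measure.pi fun _ : Fin n => μ).withDensity fun x => P.marginalLikelihood x T.root :=
    hmap ▸ P.comp_iidKernel_eq (h1 T.root)
  refine ⟨h2, hmarg, P.marginalLikelihood_of_obs_empty, P.marginalLikelihood_eq,
    P.posteriorKernel n, inferInstance,
    hmap ▸ P.isPosterior_posteriorKernel (h1 T.root) (hpos T.root), ?_⟩
  rw [hmarg]
  -- Finiteness holds `μ^n`-almost everywhere and passes to the marginal law by absolute continuity;
  -- positivity holds for every `x`, since `ρ > 0` everywhere.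
  filter_upwards [withDensity_absolutelyContinuous _ _ P.ae_marginalLikelihood_lt_top] with x hlt
  have hx : ∀ A, 0 < P.marginalLikelihood x A ∧ P.marginalLikelihood x A < ⊤ := fun A =>
    ⟨P.marginalLikelihood_pos x (hpos A), hlt A⟩
  exact ⟨hx, P.posterior x hx, fun _ => rfl, fun _ _ => rfl, fun _ _ _ => rfl,
    P.isOptionalPolyaTree_posteriorKernel (h1 T.root) hx⟩
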